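/- **Setting.** There are $n\ge 1$ users and $m\ge 1$ channels; $s=\max\{n,m\}$ and $[k]=\{1,\dots,k\}$. In slot $t\in\{1,2,\dots\}$ the link states form a random matrix $S(t)\in\{0,1\}^{n\times m}$; the matrices $S(1),S(2),\dots$ are independent, and $\mathbb P\{S_{i,j}(t)=1\}=q_{i,j}$. An assignment is a matrix $Y(t)\in\{0,1\}^{n\times m}$ with all row sums and all column sums at most $1$, and $X_i(t)=\sum_{j=1}^m Y_{i,j}(t)S_{i,j}(t)$. The utility $\phi$ is concave and entrywise nondecreasing on $[0,1]^n$ and has at every point of $[0,1]^n$ a subgradient with entries bounded by $B$ in absolute value; $\phi^{\max}=\max_{x\in[0,1]^n}|\phi(x)|$. Let $\phi^{\mathrm{opt}}$ be the supremum of $\liminf_{T\to\infty}\phi\big(\frac1T\sum_{t=1}^T\mathbb E\{X(t)\}\big)$ over all random assignments $Y(1),Y(2),\dots$ such that $Y(t)$ is independent of $S(\tau)$ for all $\tau\ge t$ and, for $\tau<t$, $Y(t)$ is independent of $S_{i,j}(\tau)$ given $Y_{i,j}(\tau)\ne 1$. **Algorithm (UCB MAC)** with parameters $V>0$ and $\delta_t>0$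 $(t\ge s)$. For $t\in[s]$ choose assignments $Y(t)$ such that each link $(i,j)$ is used exactly once in these $s$ slots. Put $$n_{i,j}(t)=\sum_{\tau=1}^tY_{i,j}(\tau),\quad \hat S_{i,j}(t)=\frac{\sum_{\tau=1}^tY_{i,j}(\tau)S_{i,j}(\tau)}{n_{i,j}(t)},\quad f_{i,j}(t)=\sqrt{\frac{\log\big(n_{i,j}(t)(n_{i,j}(t)+1)/\delta_t\big)}{2n_{i,j}(t)}}$$ (with $f_{i,j}(t)=0$ where the logarithm is negative) and $\mathrm{UCB}_{i,j}(t)=\hat S_{i,j}(t)+f_{i,j}(t)$. Start with $Q(s+1)=0$. In each slot $t\ge s+1$ choose $$\gamma(t)\in\arg\min_{\gamma\in[0,1]^n}\Big[-V\phi(\gamma)+\sum_{i=1}^nQ_i(t)\gamma_i\Big]$$ and an $s\times s$ permutation matrix $M(t)$ that maximizes $\sum_{i=1}^n\sum_{j=1}^mQ_i(t)\,\mathrm{UCB}_{i,j}(t-1)\,M_{i,j}$ over all doubly stochastic $s\times s$ matrices $M$; use $Y_{i,j}(t)=M_{i,j}(t)$ for $(i,j)\in[n]\times[m]$; then set $Q_i(t+1)=\max\{Q_i(t)+\gamma_i(t)-X_i(t),0\}$.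 All choices for slot $t$, including the exploration schedule and the choice among several optimizers, are made from the information available at the end of slot $t-1$ (the feedback $Y(\tau)\odot S(\tau)$ (entrywise product), $\tau<t$, and possibly extra randomness), which is independent of $S(t)$. **Theorem.** For every $T\in\{s+1,s+2,\dots\}$, $$\begin{aligned}\phi^{\mathrm{opt}}-\phi\Big(\mathbb E\Big\{\frac1T\sum_{t=1}^TX(t)\Big\}\Big)\le{}&\frac nV+\frac{2(BV+1)}{V(T-s)}\sum_{t=s+1}^T\sum_{i=1}^n\sum_{j=1}^m\mathbb E\{Y_{i,j}(t)f_{i,j}(t-1)\}\\&+\frac{2(2V\phi^{\max}+nBV+n)nm}{V(T-s)}\sum_{t=s}^{T-1}\delta_t+\frac{nB(BV+1)}{T-s}+\frac{B\min\{n,m\}\,s}{T}.\end{aligned}$$ Moreover, if $\delta_t=1/t$ for all $t\ge s$, then: 1. For all $V>0$ and $T\ge s+1$, $$\begin{aligned}\phi^{\mathrm{opt}}-\phi\Big(\mathbb E\Big\{\frac1T\sum_{t=1}^TX(t)\Big\}\Big)\le{}&\frac nV+\frac{2\sqrt6\,nm(BV+1)\sqrt{T\log T}}{V(T-s)}\\&+\frac{2(2V\phi^{\max}+nBV+n)nm(\log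 T+1)}{V(T-s)}+\frac{nB(BV+1)}{T-s}+\frac{(\sqrt nB+1)s}{T}.\end{aligned}$$ 2. If $T\ge 2s$ and $V=\Theta(\sqrt T)$, then $\phi^{\mathrm{opt}}-\phi\big(\mathbb E\{\frac1T\sum_{t=1}^TX(t)\}\big)=O\big(\sqrt{\log T/T}\big)$: for all $c_1,c_2>0$ there is $C$, depending only on $n,m,\phi,B,c_1,c_2$, such that the absolute value of the left side is at most $C\sqrt{\log T/T}$ whenever $T\ge2s$ and $c_1\sqrt T\le V\le c_2\sqrt T$. 3. If $\epsilon>0$ and $V=\Theta(1/\epsilon)$, then $\phi^{\mathrm{opt}}-\liminf_{T\to\infty}\phi\big(\mathbb E\{\frac1T\sum_{t=1}^TX(t)\}\big)=O(\epsilon)$: for all $c_1,c_2>0$ there is $C$, depending only on $n,m,\phi,B,c_1,c_2$, such that the absolute value of the left side is at most $C\epsilon$ whenever $\epsilon>0$ and $c_1/\epsilon\le V\le c_2/\epsilon$. -/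

import Mathlib

open MeasureTheory ProbabilityTheory Filter

universe u

noncomputable section

namespace MAC

/-- The cube `[0,1]^n`. -/
abbrev cube (n : ℕ) : Set (Fin n → ℝ) := Set.Icc 0 1

/-- A utility function on `[0,1]^n`: concave, entrywise nondecreasing, and having at every point of
the cube a subgradient (in the sense of concave functions) with all entries bounded by `B` in
absolute value. -/
structure IsUtility {n : ℕ} (φ : (Fin n → ℝ) → ℝ) (B : ℝ) : Prop where
  concave : ConcaveOn ℝ (cube n) φ
  mono : MonotoneOn φ (cube n)
  subgrad : ∀ x ∈ cube n, ∃ g : Fin n → ℝ, (∀ i, |g i| ≤ B) ∧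
    ∀ y ∈ cube n, φ y ≤ φ x + ∑ i, g i * (y i - x i)

/-- `φ^max`, the maximum of `|φ|` over the cube. -/
def phiMax {n : ℕ} (φ : (Fin n → ℝ) → ℝ) : ℝ := sSup ((fun x => |φ x|) '' cube n)

/-- A 0/1 assignment of `n` users to `m` channels: every channel gets at most one user and every
user gets at most one channel. -/
structure IsAssignment {n m : ℕ} (y : Fin n → Fin m → ℝ) : Prop where
  zero_one : ∀ i j, y i j = 0 ∨ y i j = 1
  channel : ∀ j, ∑ i, y i j ≤ 1
  user : ∀ i, ∑ j, y i j ≤ 1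

section Processes

variable {Ω : Type u} [MeasurableSpace Ω] {n m : ℕ}

/-- The link states `S t` in the slots `t = 1, 2, …` (the value at `t = 0` is irrelevant): 0/1 valued
random matrices, independent over the slots, where link `(i,j)` is successful in each slot with
probability `q i j`. Nothing is assumed on the joint law of different links in one slot. -/
structure IsLinkProcess (P : Measure Ω) (q : Fin n → Fin m → ℝ)
    (S : ℕ → Ω → Fin n → Fin m → ℝ) : Prop where
  meas : ∀ t, 1 ≤ t → Measurable (S t)
  zero_one : ∀ t, 1 ≤ t → ∀ ω i j, S t ω i j = 0 ∨ S t ω i j = 1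
  prob : ∀ t, 1 ≤ t → ∀ i j, P.real {ω | S t ω i j = 1} = q i j
  indep : iIndepFun (fun t : ℕ => S (t + 1)) P

/-- `X_i(t) = ∑_j Y_{i,j}(t) S_{i,j}(t)`. -/
def success (S Y : ℕ → Ω → Fin n → Fin m → ℝ) (t : ℕ) (ω : Ω) (i : Fin n) : ℝ :=
  ∑ j, Y t ω i j * S t ω i j

/-- The vector `E{(1/T) ∑_{t=1}^T X(t)}`. -/
def meanSuccess (P : Measure Ω) (S Y : ℕ → Ω → Fin n → Fin m → ℝ) (T : ℕ) : Fin n → ℝ :=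
  fun i => ∫ ω, (1 / (T : ℝ)) * ∑ t ∈ Finset.Icc 1 T, success S Y t ω i ∂P

/-- The constraints on the decisions `Y 1, Y 2, …` in the utility maximization problem. Decisions do
not know the current and future link states, and an outcome that was not observed carries no
information: conditionally on `Y_{i,j}(τ) ≠ 1`, the later decision `Y(t)` is independent of
`S_{i,j}(τ)`. -/
structure IsAdmissible (P : Measure Ω) (S Y : ℕ → Ω → Fin n → Fin m → ℝ) : Prop where
  meas : ∀ t, 1 ≤ t → Measurable (Y t)
  assignment : ∀ t, 1 ≤ t → ∀ ω, IsAssignment (Y t ω)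
  indep_future : ∀ t τ, 1 ≤ t → t ≤ τ → IndepFun (Y t) (S τ) P
  indep_unobserved : ∀ t τ, 1 ≤ τ → τ < t → ∀ i j,
    IndepFun (Y t) (fun ω => S τ ω i j) (cond P {ω | Y τ ω i j ≠ 1})

/-- The objective values `liminf_{T → ∞} φ((1/T) ∑_{t ≤ T} E X(t))` of all admissible decisions. -/
def achievable (P : Measure Ω) (S : ℕ → Ω → Fin n → Fin m → ℝ) (φ : (Fin n → ℝ) → ℝ) : Set ℝ :=
  {v | ∃ Y : ℕ → Ω → Fin n → Fin m → ℝ, IsAdmissible P S Y ∧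
    v = liminf (fun T : ℕ => φ (meanSuccess P S Y T)) atTop}

/-- `φ^opt`, the optimal value of the utility maximization problem. -/
def phiOpt (P : Measure Ω) (S : ℕ → Ω → Fin n → Fin m → ℝ) (φ : (Fin n → ℝ) → ℝ) : ℝ :=
  sSup (achievable P S φ)

/-- `n_{i,j}(t)`, the number of slots in `[1,t]` in which link `(i,j)` was used. -/
def pulls (Y : ℕ → Ω → Fin n → Fin m → ℝ) (t : ℕ) (ω : Ω) (i : Fin n) (j : Fin m) : ℝ :=
  ∑ τ ∈ Finset.Icc 1 t, Y τ ω i j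

/-- The empirical success rate of link `(i,j)`; it is `0` if the link was never used, because of
`x / 0 = 0`. -/
def empMean (S Y : ℕ → Ω → Fin n → Fin m → ℝ) (t : ℕ) (ω : Ω) (i : Fin n) (j : Fin m) : ℝ :=
  (∑ τ ∈ Finset.Icc 1 t, Y τ ω i j * S τ ω i j) / pulls Y t ω i j

/-- The confidence width `f_{i,j}(t)`. -/
def confWidth (δ : ℕ → ℝ) (Y : ℕ → Ω → Fin n → Fin m → ℝ) (t : ℕ) (ω : Ω)
    (i : Fin n) (j : Fin m) : ℝ :=
  √(Real.log (pulls Y t ω i j * (pulls Y t ω i j + 1) / δ t) / (2 * pulls Y t ω i j))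

/-- `UCB_{i,j}(t)`. -/
def ucb (δ : ℕ → ℝ) (S Y : ℕ → Ω → Fin n → Fin m → ℝ) (t : ℕ) (ω : Ω)
    (i : Fin n) (j : Fin m) : ℝ :=
  empMean S Y t ω i j + confWidth δ Y t ω i j

/-- User `i` as a row of an `s × s` matrix, `s = max n m`. -/
abbrev row (m : ℕ) {n : ℕ} (i : Fin n) : Fin (max n m) := Fin.castLE (le_max_left n m) i

/-- Channel `j` as a column of an `s × s` matrix, `s = max n m`. -/
abbrev col (n : ℕ) {m : ℕ} (j : Fin m) : Fin (max n m) := Fin.castLE (le_max_right n m) j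

/-- The max-weight objective `∑_{i ≤ n} ∑_{j ≤ m} Q_i U_{i,j} A_{i,j}` of an `s × s` matrix `A`. -/
def weight (Q : Fin n → ℝ) (U : Fin n → Fin m → ℝ)
    (A : Matrix (Fin (max n m)) (Fin (max n m)) ℝ) : ℝ :=
  ∑ i, ∑ j, Q i * U i j * A (row m i) (col n j)

/-- The processes `Y` (assignments), `M` (permutation matrices), `γ` (auxiliary vectors) and `Q`
(virtual queues) form a run of the algorithm UCB MAC with parameters `V` and `δ` on the link states
`S`. The σ-algebra `ℱ t` is the information that the controller has at the end of slot `t`; the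
exploration schedule in the slots `1, …, s`, and the choice among several optimizers later on, are
arbitrary (they may depend on this information and may be randomized). -/
structure IsUCBRun (P : Measure Ω) (S : ℕ → Ω → Fin n → Fin m → ℝ) (φ : (Fin n → ℝ) → ℝ)
    (V : ℝ) (δ : ℕ → ℝ) (ℱ : Filtration ℕ ‹MeasurableSpace Ω›)
    (Y : ℕ → Ω → Fin n → Fin m → ℝ)
    (M : ℕ → Ω → Matrix (Fin (max n m)) (Fin (max n m)) ℝ)
    (γ Q : ℕ → Ω → Fin n → ℝ) : Prop where
  /-- The link states of slot `t + 1` are independent of what is known at the end of slot `t`. -/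
  indep_past : ∀ t, Indep (MeasurableSpace.comap (S (t + 1)) inferInstance) (ℱ t) P
  /-- The feedback of a slot is known at its end. -/
  feedback_meas : ∀ t, 1 ≤ t → Measurable[ℱ t] (fun ω i j => Y t ω i j * S t ω i j)
  /-- The decisions for slot `t + 1` are made from what is known at the end of slot `t`. -/
  Y_meas : ∀ t, Measurable[ℱ t] (Y (t + 1))
  γ_meas : ∀ t, max n m ≤ t → Measurable[ℱ t] (γ (t + 1))
  explore_assignment : ∀ t, 1 ≤ t → t ≤ max n m → ∀ ω, IsAssignment (Y t ω)
  explore_once : ∀ ω i j, ∃! t, t ∈ Finset.Icc 1 (max n m) ∧ Y t ω i j = 1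
  Q_init : ∀ ω, Q (max n m + 1) ω = 0
  γ_mem : ∀ t, max n m < t → ∀ ω, γ t ω ∈ cube n
  γ_min : ∀ t, max n m < t → ∀ ω,
    IsMinOn (fun g : Fin n → ℝ => -V * φ g + ∑ i, Q t ω i * g i) (cube n) (γ t ω)
  M_perm : ∀ t, max n m < t → ∀ ω, ∃ σ : Equiv.Perm (Fin (max n m)), M t ω = σ.permMatrix ℝ
  M_max : ∀ t, max n m < t → ∀ ω,
    IsMaxOn (weight (Q t ω) (ucb δ S Y (t - 1) ω))
      (doublyStochastic ℝ (Fin (max n m)) : Set (Matrix _ _ ℝ)) (M t ω)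
  Y_eq : ∀ t, max n m < t → ∀ ω i j, Y t ω i j = M t ω (row m i) (col n j)
  Q_step : ∀ t, max n m < t → ∀ ω i,
    Q (t + 1) ω i = max (Q t ω i + γ t ω i - success S Y t ω i) 0

/-- Some decisions are admissible, so the supremum that defines `phiOpt` is over a nonempty set. -/
theorem achievable_nonempty (P : Measure Ω) [IsProbabilityMeasure P]
    (S : ℕ → Ω → Fin n → Fin m → ℝ) (φ : (Fin n → ℝ) → ℝ) : (achievable P S φ).Nonempty := by
  refine ⟨_, fun _ _ _ _ => 0, ⟨fun t _ => measurable_const, fun t _ ω => ⟨by simp, by simp, by simp⟩,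
    fun t τ _ _ => indepFun_const_left _ _, fun t τ _ _ i j => ?_⟩, rfl⟩
  have h : {ω : Ω | ((fun (_ : ℕ) (_ : Ω) (_ : Fin n) (_ : Fin m) => (0 : ℝ)) τ ω i j) ≠ 1} =
      Set.univ := by simp
  rw [h, cond_univ]
  exact indepFun_const_left (μ := P) (fun _ _ => (0 : ℝ)) (fun ω => S τ ω i j)

theorem meanSuccess_mem_cube (P : Measure Ω) [IsProbabilityMeasure P]
    {q : Fin n → Fin m → ℝ} {S Y : ℕ → Ω → Fin n → Fin m → ℝ} (hS : IsLinkProcess P q S)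
    (hY : ∀ t, 1 ≤ t → ∀ ω, IsAssignment (Y t ω)) (T : ℕ) : meanSuccess P S Y T ∈ cube n := by
  have hX : ∀ t, 1 ≤ t → ∀ ω i, 0 ≤ success S Y t ω i ∧ success S Y t ω i ≤ 1 := by
    intro t ht ω i
    constructor
    · refine Finset.sum_nonneg fun j _ => ?_
      rcases (hY t ht ω).zero_one i j with h | h <;> rcases hS.zero_one t ht ω i j with h' | h' <;>
        simp [h, h']
    · refine le_trans (Finset.sum_le_sum fun j _ => ?_) ((hY t ht ω).user i)
      rcases (hY t ht ω).zero_one i j with h | h <;> rcases hS.zero_one t ht ω i j with h' | h' <;>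
        simp [h, h']
  have h0 : ∀ ω i, 0 ≤ (1 / (T : ℝ)) * ∑ t ∈ Finset.Icc 1 T, success S Y t ω i := fun ω i =>
    mul_nonneg (by positivity)
      (Finset.sum_nonneg fun t ht => (hX t (Finset.mem_Icc.1 ht).1 ω i).1)
  have h1 : ∀ ω i, (1 / (T : ℝ)) * ∑ t ∈ Finset.Icc 1 T, success S Y t ω i ≤ 1 := by
    intro ω i
    have h : ∑ t ∈ Finset.Icc 1 T, success S Y t ω i ≤ T := by
      refine (Finset.sum_le_sum fun t ht => (hX t (Finset.mem_Icc.1 ht).1 ω i).2).trans ?_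
      simp
    rw [one_div, inv_mul_eq_div]
    exact div_le_one_of_le₀ h (Nat.cast_nonneg _)
  refine ⟨fun i => integral_nonneg fun ω => h0 ω i, fun i => ?_⟩
  refine (integral_mono_of_nonneg (Eventually.of_forall fun ω => h0 ω i)
    (integrable_const (1 : ℝ)) (Eventually.of_forall fun ω => h1 ω i)).trans ?_
  simp

/-- The supremum that defines `phiOpt` is over a set that is bounded above. -/
theorem achievable_bddAbove (P : Measure Ω) [IsProbabilityMeasure P]
    {q : Fin n → Fin m → ℝ} {S : ℕ → Ω → Fin n → Fin m → ℝ} (hS : IsLinkProcess P q S)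
    {φ : (Fin n → ℝ) → ℝ} {B : ℝ} (hφ : IsUtility φ B) : BddAbove (achievable P S φ) := by
  refine ⟨φ 1, ?_⟩
  rintro v ⟨Y, hY, rfl⟩
  have hm := fun T => meanSuccess_mem_cube P hS hY.assignment T
  have hle : ∀ T, φ (meanSuccess P S Y T) ≤ φ 1 := fun T =>
    hφ.mono (hm T) ⟨zero_le_one, le_rfl⟩ (hm T).2
  have hge : ∀ T, φ 0 ≤ φ (meanSuccess P S Y T) := fun T =>
    hφ.mono ⟨le_rfl, zero_le_one⟩ (hm T) (hm T).1
  exact liminf_le_of_frequently_le (Frequently.of_forall hle)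
    (isBoundedUnder_of ⟨φ 0, hge⟩)

end Processes

end MAC

end

set_option linter.unusedSectionVars false

namespace MAC

/-! The argument compares the algorithm with every point of the capacity region, the set of vectors
`x i = ∑ j, q i j * y i j` with `y` in the convex hull of the assignments. Since `Y t` is
independent of `S t`, the mean success vector of any admissible policy lies in this region at every
finite horizon, so it suffices to beat `φ x` for each such `x` (`IsLinkProcess.phiOpt_le`).
Conversely, each point of the region is the limit of the averages of a deterministic sequence of
assignments (`IsLinkProcess.le_phiOpt`). Hence the algorithm never exceeds `φ^opt`, which turns the
upper bounds into bounds on absolute values.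

The regret bound combines three facts. Queues: a queue above `B * V` forces the auxiliary variable
of that user to zero, so `Q i ≤ B * V + 1` surely (`Q_le`). Concentration: an exponential
supermartingale and a union bound over the number of uses show that each confidence interval fails
with probability at most `2 * δ t` (`prob_confidence_fails`). Max-weight: while all intervals hold,
optimism makes the chosen matching as good as `y` up to twice the widths of the links used;
otherwise the loss is at most `n * (B * V + 1)` (`weight_gap`).

Inserted into the drift of `∑ i, Q i ^ 2 / 2`, these bound `φ x` by the utility of the averaged
expected auxiliary vectors plus error terms (`utility_le_utility_meanγ`). The utility of the
auxiliary vectors is linearized at their overall average, where the linear terms sum to zero, so no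
expectation of `φ` is ever taken. The queue bound transfers the estimate to the averaged successes,
and discarding the exploration slots costs the last term (`utility_le`). For `δ t = 1 / t` the
widths along the uses of a link sum to order `√(T log T)` (`sum_confWidth_le`). -/

theorem IsUtility.bound_nonneg {n : ℕ} (hn : 0 < n) {φ : (Fin n → ℝ) → ℝ} {B : ℝ}
    (hφ : IsUtility φ B) : 0 ≤ B := by
  obtain ⟨g, hg, -⟩ := hφ.subgrad 0 ⟨le_rfl, zero_le_one⟩
  exact (abs_nonneg _).trans (hg ⟨0, hn⟩)

/-- By monotonicity `y` may be replaced by `y ⊔ x`. All increments from `x` are then nonnegative, so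
the subgradient entries can be replaced by their bound `B`. The one-sided form matters: only
coordinates where `x` falls short are charged. -/
theorem IsUtility.le_add_posPart {n : ℕ} {φ : (Fin n → ℝ) → ℝ} {B : ℝ} (hφ : IsUtility φ B)
    {x y : Fin n → ℝ} (hx : x ∈ cube n) (hy : y ∈ cube n) :
    φ y ≤ φ x + B * ∑ i, max (y i - x i) 0 := by
  obtain ⟨g, hg, hgx⟩ := hφ.subgrad x hx
  have hw : y ⊔ x ∈ cube n := ⟨hy.1.trans le_sup_left, sup_le hy.2 hx.2⟩
  refine (hφ.mono hy hw le_sup_left).trans ((hgx _ hw).trans ?_)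
  rw [Finset.mul_sum]
  refine add_le_add_right (Finset.sum_le_sum fun i _ => ?_) _
  have h : (y ⊔ x) i - x i = max (y i - x i) 0 := by
    rw [Pi.sup_apply, ← max_sub_sub_right, sub_self]
  rw [h]
  exact mul_le_mul_of_nonneg_right ((le_abs_self _).trans (hg i)) (le_max_right _ _)

theorem IsUtility.abs_sub_le {n : ℕ} {φ : (Fin n → ℝ) → ℝ} {B : ℝ} (hB : 0 ≤ B)
    (hφ : IsUtility φ B) {x y : Fin n → ℝ} (hx : x ∈ cube n) (hy : y ∈ cube n) :
    |φ y - φ x| ≤ B * ∑ i, |y i - x i| := by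
  have h1 := hφ.le_add_posPart hx hy
  have h2 := hφ.le_add_posPart hy hx
  have h3 : B * ∑ i, max (y i - x i) 0 ≤ B * ∑ i, |y i - x i| := by
    gcongr; exact max_le (le_abs_self _) (abs_nonneg _)
  have h4 : B * ∑ i, max (x i - y i) 0 ≤ B * ∑ i, |y i - x i| := by
    gcongr; rw [abs_sub_comm]; exact max_le (le_abs_self _) (abs_nonneg _)
  rw [abs_le]; constructor <;> linarith

/-! ### Assignments as partial permutations -/

namespace IsAssignment

variable {n m : ℕ} {a : Fin n → Fin m → ℝ}

theorem nonneg (ha : IsAssignment a) (i : Fin n) (j : Fin m) : 0 ≤ a i j := by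
  rcases ha.zero_one i j with h | h <;> simp [h]

theorem le_one (ha : IsAssignment a) (i : Fin n) (j : Fin m) : a i j ≤ 1 := by
  rcases ha.zero_one i j with h | h <;> simp [h]

theorem user_unique (ha : IsAssignment a) {i i' : Fin n} {j : Fin m} (h : a i j = 1)
    (h' : a i' j = 1) : i = i' := by
  by_contra hne
  have := Finset.sum_le_sum_of_subset_of_nonneg (Finset.subset_univ {i, i'})
    (fun k _ _ => ha.nonneg k j)
  rw [Finset.sum_pair hne, h, h'] at this
  linarith [ha.channel j]

theorem channel_unique (ha : IsAssignment a) {i : Fin n} {j j' : Fin m} (h : a i j = 1)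
    (h' : a i j' = 1) : j = j' := by
  by_contra hne
  have := Finset.sum_le_sum_of_subset_of_nonneg (Finset.subset_univ {j, j'})
    (fun k _ _ => ha.nonneg i k)
  rw [Finset.sum_pair hne, h, h'] at this
  linarith [ha.user i]

theorem zero : IsAssignment (fun (_ : Fin n) (_ : Fin m) => (0 : ℝ)) :=
  ⟨by simp, by simp, by simp⟩

/-- The total number of links used is at most `min n m`. -/
theorem sum_le_min (ha : IsAssignment a) : ∑ i, ∑ j, a i j ≤ (min n m : ℕ) := by
  rcases le_total n m with h | h
  · rw [min_eq_left h]
    simpa using Finset.sum_le_sum (fun i (_ : i ∈ Finset.univ) => ha.user i)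
  · rw [min_eq_right h, Finset.sum_comm]
    simpa using Finset.sum_le_sum (fun j (_ : j ∈ Finset.univ) => ha.channel j)

/-- The used links form an injective partial map from rows to columns of a square index set, and any
such map extends to a bijection. -/
theorem exists_perm (ha : IsAssignment a) : ∃ σ : Equiv.Perm (Fin (max n m)),
    ∀ i j, a i j = 1 → σ (row m i) = col n j := by
  classical
  rcases Nat.eq_zero_or_pos (max n m) with h0 | hpos
  · exact ⟨1, fun i => absurd (i.pos.trans_le (le_max_left n m)) (by omega)⟩
  have : Nonempty (Fin (max n m)) := ⟨⟨0, hpos⟩⟩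
  let s : Finset (Fin (max n m)) := Finset.univ.filter fun r => ∃ i j, row m i = r ∧ a i j = 1
  have hs : ∀ r, r ∈ s → ∃ c, ∃ i j, row m i = r ∧ col n j = c ∧ a i j = 1 := by
    intro r hr
    obtain ⟨i, j, h1, h2⟩ := (Finset.mem_filter.1 hr).2
    exact ⟨_, i, j, h1, rfl, h2⟩
  choose! f hf using hs
  have hinj : Set.InjOn f s := by
    intro r hr r' hr' he
    obtain ⟨i, j, rfl, h2, h3⟩ := hf r hr
    obtain ⟨i', j', rfl, h2', h3'⟩ := hf r' hr'
    have hj : j = j' := Fin.castLE_injective _ (h2.trans (he.trans h2'.symm))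
    subst hj
    rw [ha.user_unique h3 h3']
  obtain ⟨g, hg⟩ := Finset.exists_equiv_extend_of_card_eq (t := Finset.univ) (by simp)
    (Finset.subset_univ (s.image f)) hinj
  refine ⟨g.trans ⟨fun x => x.1, fun x => ⟨x, Finset.mem_univ _⟩, fun _ => rfl, fun _ => rfl⟩,
    fun i j hij => ?_⟩
  have hmem : row m i ∈ s := Finset.mem_filter.2 ⟨Finset.mem_univ _, i, j, rfl, hij⟩
  obtain ⟨i', j', h1, h2, h3⟩ := hf _ hmem
  have hi : i' = i := Fin.castLE_injective _ h1
  subst hi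
  rw [ha.channel_unique hij h3, h2]
  exact hg _ hmem

/-- For nonnegative weights, an assignment is dominated by some doubly stochastic matrix. -/
theorem exists_weight_ge (ha : IsAssignment a) {Q : Fin n → ℝ} {U : Fin n → Fin m → ℝ}
    (hQ : ∀ i, 0 ≤ Q i) (hU : ∀ i j, 0 ≤ U i j) :
    ∃ A ∈ doublyStochastic ℝ (Fin (max n m)),
      ∑ i, ∑ j, Q i * U i j * a i j ≤ weight Q U A := by
  obtain ⟨σ, hσ⟩ := ha.exists_perm
  refine ⟨σ.permMatrix ℝ, permMatrix_mem_doublyStochastic, ?_⟩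
  unfold weight
  gcongr with i _ j _
  · exact mul_nonneg (hQ i) (hU i j)
  · rcases ha.zero_one i j with h | h
    · rw [h]; exact nonneg_of_mem_doublyStochastic permMatrix_mem_doublyStochastic
    · simp [h, Equiv.Perm.permMatrix, PEquiv.toMatrix_apply, hσ i j h]

end IsAssignment

/-! ### Convex combinations of assignments -/

/-- The matrices on which every linear functional is at most its supremum over the assignments,
that is, the convex hull of the assignments. -/
def IsFractional {n m : ℕ} (y : Fin n → Fin m → ℝ) : Prop :=
  ∀ (w : Fin n → Fin m → ℝ) (c : ℝ),
    (∀ a, IsAssignment a → ∑ i, ∑ j, w i j * a i j ≤ c) → ∑ i, ∑ j, w i j * y i j ≤ c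

/-- If every assignment exceeded `y` by more than 1 in direction `v`, then `-v` would separate `y`
from the assignments. The slack 1 makes it unnecessary that a minimum be attained, and it is
harmless in the greedy construction below. -/
theorem IsFractional.exists_le {n m : ℕ} {y : Fin n → Fin m → ℝ} (hy : IsFractional y)
    (v : Fin n → Fin m → ℝ) :
    ∃ a, IsAssignment a ∧ ∑ i, ∑ j, v i j * (a i j - y i j) ≤ 1 := by
  by_contra! hcon
  have := hy (fun i j => - v i j) (-(∑ i, ∑ j, v i j * y i j) - 1) fun a ha => by
    have := hcon a ha
    simp only [mul_sub, Finset.sum_sub_distrib, neg_mul, Finset.sum_neg_distrib] at this ⊢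
    linarith
  simp only [neg_mul, Finset.sum_neg_distrib] at this
  linarith

/-- Every convex combination of assignments is the limit of the averages of a fixed sequence of
assignments. -/
theorem IsFractional.exists_seq {n m : ℕ} {y : Fin n → Fin m → ℝ} (hy : IsFractional y) :
    ∃ a : ℕ → Fin n → Fin m → ℝ, (∀ t, IsAssignment (a t)) ∧ ∀ i j,
      Tendsto (fun T : ℕ => 1 / (T : ℝ) * ∑ t ∈ Finset.Icc 1 T, a t i j) atTop (nhds (y i j)) := by
  choose pick hpick hle using hy.exists_le
  -- Greedy choice: `D` is the accumulated error, and the next assignment is picked to have inner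
  -- product at most 1 with it after subtracting `y`. Then `‖D‖²` grows at most linearly, so `D T /
  -- T` tends to 0.
  let D : ℕ → Fin n → Fin m → ℝ := fun t =>
    Nat.rec (fun _ _ => 0) (fun _ d i j => d i j + (pick d i j - y i j)) t
  have hD : ∀ t i j, D (t + 1) i j = D t i j + (pick (D t) i j - y i j) := fun _ _ _ => rfl
  -- Growth of `‖D‖²` per step: twice the inner product bound 1, plus a bound on the squared
  -- increment.
  set C : ℝ := 2 + ∑ i, ∑ j, (1 + |y i j|) ^ 2 with hC
  have hC0 : 0 ≤ C := by positivity
  have hN : ∀ t : ℕ, ∑ i, ∑ j, D t i j ^ 2 ≤ C * t := by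
    intro t
    induction t with
    | zero => simp [D]
    | succ t ih =>
      have h1 : ∑ i, ∑ j, D (t + 1) i j ^ 2 = ∑ i, ∑ j, D t i j ^ 2
          + 2 * ∑ i, ∑ j, D t i j * (pick (D t) i j - y i j)
          + ∑ i, ∑ j, (pick (D t) i j - y i j) ^ 2 := by
        simp only [hD, Finset.mul_sum, ← Finset.sum_add_distrib]
        refine Finset.sum_congr rfl fun i _ => Finset.sum_congr rfl fun j _ => by ring
      have h2 : ∑ i, ∑ j, (pick (D t) i j - y i j) ^ 2 ≤ ∑ i, ∑ j, (1 + |y i j|) ^ 2 := by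
        gcongr ∑ i, ∑ j, ?_ with i _ j _
        rw [← sq_abs]
        gcongr
        refine (abs_sub _ _).trans ?_
        gcongr
        rw [abs_of_nonneg ((hpick _).nonneg i j)]
        exact (hpick _).le_one i j
      have h3 := hle (D t)
      push_cast
      rw [h1]
      linarith
  have hDle : ∀ (t : ℕ) i j, |D t i j| ≤ √(C * t) := by
    intro t i j
    refine Real.abs_le_sqrt ((?_ : D t i j ^ 2 ≤ _).trans (hN t))
    refine le_trans ?_ (Finset.single_le_sum (f := fun i => ∑ j, D t i j ^ 2)
      (fun i _ => Finset.sum_nonneg fun j _ => sq_nonneg _) (Finset.mem_univ i))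
    exact Finset.single_le_sum (f := fun j => D t i j ^ 2)
      (fun j _ => sq_nonneg _) (Finset.mem_univ j)
  refine ⟨fun t => pick (D (t - 1)), fun t => hpick _, fun i j => ?_⟩
  have hsum : ∀ T : ℕ, ∑ t ∈ Finset.Icc 1 T, pick (D (t - 1)) i j = D T i j + T * y i j := by
    intro T
    induction T with
    | zero => simp [D]
    | succ T ih =>
      rw [Finset.sum_Icc_succ_top (by omega), ih, Nat.add_sub_cancel, hD]
      push_cast; ring
  have hlim : Tendsto (fun T : ℕ => √C * (√(T : ℝ))⁻¹) atTop (nhds 0) := by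
    rw [← mul_zero √C]
    exact (tendsto_inv_atTop_zero.comp
      (Real.tendsto_sqrt_atTop.comp tendsto_natCast_atTop_atTop)).const_mul _
  rw [tendsto_iff_norm_sub_tendsto_zero]
  refine squeeze_zero' (Eventually.of_forall fun _ => norm_nonneg _) ?_ hlim
  filter_upwards [eventually_gt_atTop 0] with T hT
  have hT' : (0 : ℝ) < T := by exact_mod_cast hT
  have heq : 1 / (T : ℝ) * ∑ t ∈ Finset.Icc 1 T, pick (D (t - 1)) i j - y i j = D T i j / T := by
    rw [hsum]; field_simp; ring
  rw [heq, Real.norm_eq_abs, abs_div, abs_of_pos hT', div_le_iff₀ hT']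
  refine (hDle T i j).trans (le_of_eq ?_)
  rw [Real.sqrt_mul hC0]
  have := Real.sq_sqrt hT'.le
  have hs : √(T : ℝ) ≠ 0 := by positivity
  field_simp
  rw [this]

theorem measurable_entry {Ω : Type u} {n m : ℕ} {m₀ : MeasurableSpace Ω} {A : Ω → Fin n → Fin m → ℝ}
    (hA : Measurable[m₀] A) (i : Fin n) (j : Fin m) : Measurable[m₀] fun ω => A ω i j :=
  (measurable_pi_apply j).comp ((measurable_pi_apply i).comp hA)

/-! ### The capacity region and `φ^opt` -/

section

variable {Ω : Type u} [MeasurableSpace Ω] {n m : ℕ} {P : Measure Ω} [IsProbabilityMeasure P]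
  {q : Fin n → Fin m → ℝ} {S Y : ℕ → Ω → Fin n → Fin m → ℝ} {φ : (Fin n → ℝ) → ℝ} {B : ℝ}

theorem IsLinkProcess.integral_eq (hS : IsLinkProcess P q S) {t : ℕ} (ht : 1 ≤ t) (i : Fin n)
    (j : Fin m) : ∫ ω, S t ω i j ∂P = q i j := by
  have hm : MeasurableSet {ω | S t ω i j = 1} :=
    measurable_entry (hS.meas t ht) i j (measurableSet_singleton 1)
  rw [← hS.prob t ht i j, ← integral_indicator_one hm]
  refine integral_congr_ae (Eventually.of_forall fun ω => ?_)
  rcases hS.zero_one t ht ω i j with h | h <;> simp [Set.indicator, h]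

theorem IsLinkProcess.prob_mem (hS : IsLinkProcess P q S) (i : Fin n) (j : Fin m) :
    q i j ∈ Set.Icc (0 : ℝ) 1 := by
  rw [← hS.prob 1 le_rfl i j]
  exact ⟨measureReal_nonneg, measureReal_le_one⟩

theorem integrable_assignment {t : ℕ} (hm : Measurable (Y t))
    (ha : ∀ ω, IsAssignment (Y t ω)) (i : Fin n) (j : Fin m) :
    Integrable (fun ω => Y t ω i j) P :=
  Integrable.of_bound (measurable_entry hm i j).aestronglyMeasurable 1
    (Eventually.of_forall fun ω => by rcases (ha ω).zero_one i j with h | h <;> simp [h])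

theorem IsLinkProcess.integrable_mul (hS : IsLinkProcess P q S) {t : ℕ} (ht : 1 ≤ t)
    {f : Ω → ℝ} (hf : Integrable f P) (i : Fin n) (j : Fin m) :
    Integrable (fun ω => f ω * S t ω i j) P := by
  refine hf.mul_bdd (c := 1) (measurable_entry (hS.meas t ht) i j).aestronglyMeasurable
    (Eventually.of_forall fun ω => ?_)
  rcases hS.zero_one t ht ω i j with h | h <;> simp [h]

theorem IsLinkProcess.integrable_success (hS : IsLinkProcess P q S) {t : ℕ} (ht : 1 ≤ t)
    (hm : Measurable (Y t)) (ha : ∀ ω, IsAssignment (Y t ω)) (i : Fin n) :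
    Integrable (fun ω => success S Y t ω i) P :=
  integrable_finsetSum _ fun j _ => hS.integrable_mul ht (integrable_assignment hm ha i j) i j

theorem IsLinkProcess.integral_success (hS : IsLinkProcess P q S) {t : ℕ} (ht : 1 ≤ t)
    (hm : Measurable (Y t)) (ha : ∀ ω, IsAssignment (Y t ω)) (hind : IndepFun (Y t) (S t) P)
    (i : Fin n) : ∫ ω, success S Y t ω i ∂P = ∑ j, q i j * ∫ ω, Y t ω i j ∂P := by
  unfold success
  rw [integral_finsetSum _ fun j _ =>
    hS.integrable_mul ht (integrable_assignment hm ha i j) i j]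
  refine Finset.sum_congr rfl fun j _ => ?_
  have hij : IndepFun (fun ω => Y t ω i j) (fun ω => S t ω i j) P :=
    hind.comp (measurable_entry measurable_id i j) (measurable_entry measurable_id i j)
  rw [hij.integral_fun_mul_eq_mul_integral (measurable_entry hm i j).aestronglyMeasurable
    (measurable_entry (hS.meas t ht) i j).aestronglyMeasurable, hS.integral_eq ht, mul_comm]

/-- The expected fraction of the slots `1, …, T` in which the links are used. -/
noncomputable def avgUse (P : Measure Ω) (Y : ℕ → Ω → Fin n → Fin m → ℝ) (T : ℕ) (i : Fin n)
    (j : Fin m) : ℝ :=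
  1 / (T : ℝ) * ∑ t ∈ Finset.Icc 1 T, ∫ ω, Y t ω i j ∂P

theorem IsLinkProcess.meanSuccess_eq (hS : IsLinkProcess P q S)
    (hm : ∀ t, 1 ≤ t → Measurable (Y t)) (ha : ∀ t, 1 ≤ t → ∀ ω, IsAssignment (Y t ω))
    (hind : ∀ t, 1 ≤ t → IndepFun (Y t) (S t) P) (T : ℕ) :
    meanSuccess P S Y T = fun i => ∑ j, q i j * avgUse P Y T i j := by
  funext i
  unfold meanSuccess avgUse
  rw [integral_const_mul, integral_finsetSum _ fun t ht =>
    hS.integrable_success (Finset.mem_Icc.1 ht).1 (hm t (Finset.mem_Icc.1 ht).1)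
      (ha t (Finset.mem_Icc.1 ht).1) i,
    Finset.sum_congr rfl fun t ht => hS.integral_success (Finset.mem_Icc.1 ht).1
      (hm t (Finset.mem_Icc.1 ht).1) (ha t (Finset.mem_Icc.1 ht).1)
      (hind t (Finset.mem_Icc.1 ht).1) i, Finset.sum_comm, Finset.mul_sum]
  refine Finset.sum_congr rfl fun j _ => ?_
  rw [← Finset.mul_sum]; ring

/-- A linear bound valid for every assignment survives taking expectations and averaging over the
slots, which is why membership is tested by linear functionals. -/
theorem isFractional_avgUse (hm : ∀ t, 1 ≤ t → Measurable (Y t))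
    (ha : ∀ t, 1 ≤ t → ∀ ω, IsAssignment (Y t ω)) {T : ℕ} (hT : 1 ≤ T) :
    IsFractional (avgUse P Y T) := by
  intro w c hc
  have hT' : (0 : ℝ) < T := by exact_mod_cast hT
  have hint : ∀ t, 1 ≤ t → ∑ i, ∑ j, w i j * ∫ ω, Y t ω i j ∂P ≤ c := by
    intro t ht
    have h1 : ∀ i j, Integrable (fun ω => w i j * Y t ω i j) P := fun i j =>
      (integrable_assignment (hm t ht) (ha t ht) i j).const_mul _
    calc ∑ i, ∑ j, w i j * ∫ ω, Y t ω i j ∂P = ∫ ω, ∑ i, ∑ j, w i j * Y t ω i j ∂P := by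
          rw [integral_finsetSum _ fun i _ => integrable_finsetSum _ fun j _ => h1 i j]
          refine Finset.sum_congr rfl fun i _ => ?_
          rw [integral_finsetSum _ fun j _ => h1 i j]
          exact Finset.sum_congr rfl fun j _ => (integral_const_mul _ _).symm
      _ ≤ ∫ _, c ∂P := integral_mono
          (integrable_finsetSum _ fun i _ => integrable_finsetSum _ fun j _ => h1 i j)
          (integrable_const c) fun ω => hc _ (ha t ht ω)
      _ = c := by simp
  have h : ∑ i, ∑ j, w i j * avgUse P Y T i j =
      1 / (T : ℝ) * ∑ t ∈ Finset.Icc 1 T, ∑ i, ∑ j, w i j * ∫ ω, Y t ω i j ∂P := by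
    rw [Finset.sum_comm (s := Finset.Icc 1 T), Finset.mul_sum]
    refine Finset.sum_congr rfl fun i _ => ?_
    rw [Finset.sum_comm (s := Finset.Icc 1 T), Finset.mul_sum]
    refine Finset.sum_congr rfl fun j _ => ?_
    unfold avgUse
    rw [← Finset.mul_sum]; ring
  rw [h, one_div, inv_mul_le_iff₀ hT']
  refine (Finset.sum_le_sum fun t ht => hint t (Finset.mem_Icc.1 ht).1).trans ?_
  simp

theorem phiMax_nonneg : 0 ≤ phiMax φ :=
  Real.sSup_nonneg (by rintro _ ⟨x, -, rfl⟩; exact abs_nonneg _)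

/-- An upper bound for the utility of all points of the capacity region bounds `φ^opt`. -/
theorem IsLinkProcess.phiOpt_le (hS : IsLinkProcess P q S) (hφ : IsUtility φ B) {c : ℝ}
    (hc : ∀ y : Fin n → Fin m → ℝ, IsFractional y → (fun i => ∑ j, q i j * y i j) ∈ cube n →
      φ (fun i => ∑ j, q i j * y i j) ≤ c) : phiOpt P S φ ≤ c := by
  refine csSup_le (achievable_nonempty P S φ) ?_
  rintro v ⟨Y, hY, rfl⟩
  have hm := fun T => meanSuccess_mem_cube P hS hY.assignment T
  have hge : ∀ T, φ 0 ≤ φ (meanSuccess P S Y T) := fun T =>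
    hφ.mono ⟨le_rfl, zero_le_one⟩ (hm T) (hm T).1
  refine liminf_le_of_frequently_le (Eventually.frequently ?_) (isBoundedUnder_of ⟨φ 0, hge⟩)
  filter_upwards [eventually_ge_atTop 1] with T hT
  have he := hS.meanSuccess_eq hY.meas hY.assignment
    (fun t ht => hY.indep_future t t ht le_rfl) T
  have := hm T
  rw [he] at this ⊢
  exact hc _ (isFractional_avgUse hY.meas hY.assignment hT) this

/-- Every point of the capacity region is attained by some fixed sequence of assignments. -/
theorem IsLinkProcess.le_phiOpt (hS : IsLinkProcess P q S) (hB : 0 ≤ B) (hφ : IsUtility φ B)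
    {y : Fin n → Fin m → ℝ} (hy : IsFractional y)
    (hcube : (fun i => ∑ j, q i j * y i j) ∈ cube n) :
    φ (fun i => ∑ j, q i j * y i j) ≤ phiOpt P S φ := by
  obtain ⟨a, ha, hlim⟩ := hy.exists_seq
  have hadm : IsAdmissible P S (fun t _ => a t) :=
    ⟨fun t _ => measurable_const, fun t _ _ => ha t, fun t τ _ _ => indepFun_const_left _ _,
      fun t τ _ _ i j => by
        by_cases h : a τ i j = 1
        -- The conditioning event is empty here, so the conditional measure is zero; in the other
        -- case the event is everything and a constant is independent of anything.
        · simp [h, indepFun_iff_measure_inter_preimage_eq_mul]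
        · simpa [h] using indepFun_const_left (μ := P) (a t) (fun ω => S τ ω i j)⟩
  refine le_csSup_of_le (achievable_bddAbove P hS hφ) ⟨_, hadm, rfl⟩ (le_of_eq ?_)
  have hmem := fun T => meanSuccess_mem_cube P hS hadm.assignment T
  have hmean : ∀ i, Tendsto (fun T => meanSuccess P S (fun t _ => a t) T i) atTop
      (nhds (∑ j, q i j * y i j)) := by
    intro i
    simp_rw [hS.meanSuccess_eq hadm.meas hadm.assignment
      (fun t ht => hadm.indep_future t t ht le_rfl)]
    refine tendsto_finsetSum _ fun j _ => Tendsto.const_mul _ ?_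
    simpa [avgUse] using hlim i j
  refine (Tendsto.liminf_eq ?_).symm
  rw [tendsto_iff_norm_sub_tendsto_zero]
  refine squeeze_zero (fun _ => norm_nonneg _)
    (fun T => hφ.abs_sub_le hB hcube (hmem T)) ?_
  rw [← mul_zero B, ← Finset.sum_const_zero (s := (Finset.univ : Finset (Fin n)))]
  refine Tendsto.const_mul _ (tendsto_finsetSum _ fun i _ => ?_)
  simpa using ((hmean i).sub_const (∑ j, q i j * y i j)).norm

end

/-! ### Runs of the algorithm: measurability and queue bounds -/

section

variable {Ω : Type u} [MeasurableSpace Ω] {n m : ℕ} {P : Measure Ω}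
  {q : Fin n → Fin m → ℝ} {S Y : ℕ → Ω → Fin n → Fin m → ℝ} {φ : (Fin n → ℝ) → ℝ} {B V : ℝ}
  {δ : ℕ → ℝ} {ℱ : Filtration ℕ ‹MeasurableSpace Ω›}
  {M : ℕ → Ω → Matrix (Fin (max n m)) (Fin (max n m)) ℝ} {γ Q : ℕ → Ω → Fin n → ℝ}

theorem isAssignment_of_perm {A : Matrix (Fin (max n m)) (Fin (max n m)) ℝ}
    (hA : ∃ σ : Equiv.Perm (Fin (max n m)), A = σ.permMatrix ℝ) :
    IsAssignment fun (i : Fin n) (j : Fin m) => A (row m i) (col n j) := by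
  obtain ⟨σ, rfl⟩ := hA
  have hd : σ.permMatrix ℝ ∈ doublyStochastic ℝ (Fin (max n m)) := permMatrix_mem_doublyStochastic
  refine ⟨fun i j => ?_, fun j => ?_, fun i => ?_⟩
  · rw [Equiv.Perm.permMatrix, PEquiv.toMatrix_apply]
    split_ifs <;> simp
  · rw [← sum_col_of_mem_doublyStochastic hd (col n j),
      ← Finset.sum_image (f := fun r => σ.permMatrix ℝ r (col n j)) (g := row m)
        (fun _ _ _ _ h => Fin.castLE_injective _ h)]
    exact Finset.sum_le_sum_of_subset_of_nonneg (Finset.subset_univ _)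
      fun _ _ _ => nonneg_of_mem_doublyStochastic hd
  · rw [← sum_row_of_mem_doublyStochastic hd (row m i),
      ← Finset.sum_image (f := fun c => σ.permMatrix ℝ (row m i) c) (g := col n)
        (fun _ _ _ _ h => Fin.castLE_injective _ h)]
    exact Finset.sum_le_sum_of_subset_of_nonneg (Finset.subset_univ _)
      fun _ _ _ => nonneg_of_mem_doublyStochastic hd

theorem success_mem (hS : IsLinkProcess P q S) {t : ℕ} (ht : 1 ≤ t)
    {ω : Ω} (ha : IsAssignment (Y t ω)) (i : Fin n) : success S Y t ω i ∈ Set.Icc (0 : ℝ) 1 := by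
  constructor
  · refine Finset.sum_nonneg fun j _ => mul_nonneg (ha.nonneg i j) ?_
    rcases hS.zero_one t ht ω i j with h | h <;> simp [h]
  · refine le_trans (Finset.sum_le_sum fun j _ => mul_le_of_le_one_right (ha.nonneg i j) ?_)
      (ha.user i)
    rcases hS.zero_one t ht ω i j with h | h <;> simp [h]

namespace IsUCBRun

theorem assignment (hr : IsUCBRun P S φ V δ ℱ Y M γ Q) {t : ℕ} (ht : 1 ≤ t) (ω : Ω) :
    IsAssignment (Y t ω) := by
  rcases le_or_gt t (max n m) with h | h
  · exact hr.explore_assignment t ht h ω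
  · have he : Y t ω = fun i j => M t ω (row m i) (col n j) := by
      funext i j; exact hr.Y_eq t h ω i j
    rw [he]
    exact isAssignment_of_perm (hr.M_perm t h ω)

theorem measurable_Y (hr : IsUCBRun P S φ V δ ℱ Y M γ Q) {t : ℕ} (ht : 1 ≤ t) :
    Measurable (Y t) := by
  obtain ⟨u, rfl⟩ := Nat.exists_eq_add_of_le' ht
  exact (hr.Y_meas u).mono (ℱ.le u) le_rfl

theorem indepFun (hr : IsUCBRun P S φ V δ ℱ Y M γ Q) {α : Type*} [MeasurableSpace α] {t : ℕ}
    {W : Ω → α} (hW : Measurable[ℱ t] W) : IndepFun W (S (t + 1)) P := by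
  rw [IndepFun_iff_Indep]
  exact indep_of_indep_of_le_left (hr.indep_past t).symm hW.comap_le

/-- What is known at the end of slot `t` is uncorrelated with functions of the next link state. -/
theorem integral_mul (hr : IsUCBRun P S φ V δ ℱ Y M γ Q) (hS : IsLinkProcess P q S) {t : ℕ}
    {W : Ω → ℝ} (hW : Measurable[ℱ t] W) {h : ℝ → ℝ} (hh : Measurable h) (i : Fin n)
    (j : Fin m) : ∫ ω, W ω * h (S (t + 1) ω i j) ∂P =
      (∫ ω, W ω ∂P) * ∫ ω, h (S (t + 1) ω i j) ∂P := by
  have hind : IndepFun W (fun ω => h (S (t + 1) ω i j)) P :=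
    (hr.indepFun hW).comp measurable_id (hh.comp (measurable_entry measurable_id i j))
  exact hind.integral_fun_mul_eq_mul_integral (hW.mono (ℱ.le t) le_rfl).aestronglyMeasurable
    (hh.comp (measurable_entry (hS.meas _ (by omega)) i j)).aestronglyMeasurable

theorem measurable_success (hr : IsUCBRun P S φ V δ ℱ Y M γ Q) {t : ℕ} (ht : 1 ≤ t)
    (i : Fin n) : Measurable[ℱ t] fun ω => success S Y t ω i :=
  Finset.measurable_sum _ fun j _ => measurable_entry (hr.feedback_meas t ht) i j

theorem measurable_Q (hr : IsUCBRun P S φ V δ ℱ Y M γ Q) {t : ℕ} (ht : max n m ≤ t)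
    (i : Fin n) : Measurable[ℱ t] fun ω => Q (t + 1) ω i := by
  induction t, ht using Nat.le_induction with
  | base => simp [hr.Q_init]
  | succ t ht ih =>
    have h : (fun ω => Q (t + 1 + 1) ω i) = fun ω =>
        max (Q (t + 1) ω i + γ (t + 1) ω i - success S Y (t + 1) ω i) 0 := by
      funext ω; exact hr.Q_step (t + 1) (by omega) ω i
    rw [h]
    have h1 := ih.mono (ℱ.mono (Nat.le_succ t)) le_rfl
    have h2 := ((measurable_pi_apply i).comp (hr.γ_meas t ht)).mono (ℱ.mono (Nat.le_succ t)) le_rfl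
    exact ((h1.add h2).sub (hr.measurable_success (by omega) i)).max measurable_const

theorem Q_nonneg (hr : IsUCBRun P S φ V δ ℱ Y M γ Q) {t : ℕ} (ht : max n m < t) (ω : Ω)
    (i : Fin n) : 0 ≤ Q t ω i := by
  obtain ⟨u, rfl⟩ := Nat.exists_eq_add_of_lt ht
  cases u with
  | zero => simp [hr.Q_init]
  | succ u =>
    have := hr.Q_step (max n m + u + 1) (by omega) ω i
    rw [show max n m + (u + 1) + 1 = max n m + u + 1 + 1 by ring, this]
    exact le_max_right _ _

/-- Setting coordinate `i` of the minimizer to zero loses at most `V * B * γ i` in utility and saves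
`Q i * γ i` in queue cost. This would be a strict gain if `γ i` were positive. -/
theorem γ_eq_zero_of_lt (hr : IsUCBRun P S φ V δ ℱ Y M γ Q) (hV : 0 < V) (hφ : IsUtility φ B)
    {t : ℕ} (ht : max n m < t) {ω : Ω} {i : Fin n} (hQ : B * V < Q t ω i) : γ t ω i = 0 := by
  have hγ := hr.γ_mem t ht ω
  have hmem : Function.update (γ t ω) i 0 ∈ cube n := by
    constructor <;> intro k <;> by_cases hk : k = i
    · subst hk; simp
    · simpa [hk] using hγ.1 k
    · subst hk; simp
    · simpa [hk] using hγ.2 k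
  have hmin := hr.γ_min t ht ω hmem
  have hsub := hφ.le_add_posPart hmem hγ
  have h1 : ∑ k, max (γ t ω k - Function.update (γ t ω) i 0 k) 0 = γ t ω i := by
    rw [Finset.sum_eq_single i]
    · simpa using hγ.1 i
    · intro k _ hk; simp [hk]
    · simp
  have h2 : ∑ k, Q t ω k * γ t ω k =
      ∑ k, Q t ω k * Function.update (γ t ω) i 0 k + Q t ω i * γ t ω i := by
    rw [← sub_eq_iff_eq_add', ← Finset.sum_sub_distrib, Finset.sum_eq_single i]
    · simp
    · intro k _ hk; simp [hk]
    · simp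
  rw [h1] at hsub
  simp only [Set.mem_ofPred_eq] at hmin
  rw [h2] at hmin
  have h3 := mul_le_mul_of_nonneg_left hsub hV.le
  have h0 := hγ.1 i
  rw [Pi.zero_apply] at h0
  by_contra hne
  have hpos : 0 < γ t ω i := lt_of_le_of_ne h0 (Ne.symm hne)
  have := mul_lt_mul_of_pos_right hQ hpos
  nlinarith

/-- A queue of at most `B * V` grows by at most 1 in a slot, and a larger one receives no arrivals
and cannot grow. -/
theorem Q_le (hr : IsUCBRun P S φ V δ ℱ Y M γ Q) (hS : IsLinkProcess P q S) (hV : 0 < V)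
    (hB : 0 ≤ B) (hφ : IsUtility φ B) {t : ℕ} (ht : max n m < t) (ω : Ω) (i : Fin n) :
    Q t ω i ≤ B * V + 1 := by
  have hBV : 0 ≤ B * V := by positivity
  induction t, (show max n m + 1 ≤ t from ht) using Nat.le_induction with
  | base => rw [hr.Q_init]; simp only [Pi.zero_apply]; linarith
  | succ t ht' ih =>
    have hlt : max n m < t := ht'
    rw [hr.Q_step t hlt ω i]
    have hX := (success_mem hS (by omega : 1 ≤ t) (hr.assignment (by omega) ω) i).1
    refine max_le ?_ (by linarith)
    rcases le_or_gt (Q t ω i) (B * V) with h | h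
    · have := (hr.γ_mem t hlt ω).2 i
      rw [Pi.one_apply] at this
      linarith
    · rw [hr.γ_eq_zero_of_lt hV hφ hlt h]
      linarith [ih hlt]

/-- The number of uses of a link up to slot `t` is a natural number. -/
theorem exists_pulls_eq (hr : IsUCBRun P S φ V δ ℱ Y M γ Q) (t : ℕ) (ω : Ω) (i : Fin n)
    (j : Fin m) : ∃ k : ℕ, pulls Y t ω i j = k ∧ k ≤ t := by
  induction t with
  | zero => exact ⟨0, by simp [pulls]⟩
  | succ t ih =>
    obtain ⟨k, hk, hkt⟩ := ih
    unfold pulls at hk ⊢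
    rw [Finset.sum_Icc_succ_top (by omega), hk]
    rcases (hr.assignment (by omega : 1 ≤ t + 1) ω).zero_one i j with h | h
    · exact ⟨k, by simp [h], by omega⟩
    · exact ⟨k + 1, by simp [h], by omega⟩

theorem one_le_pulls (hr : IsUCBRun P S φ V δ ℱ Y M γ Q) {t : ℕ} (ht : max n m ≤ t) (ω : Ω)
    (i : Fin n) (j : Fin m) : 1 ≤ pulls Y t ω i j := by
  obtain ⟨τ, ⟨hτ, h1⟩, -⟩ := hr.explore_once ω i j
  rw [Finset.mem_Icc] at hτ
  unfold pulls
  rw [← h1]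
  exact Finset.single_le_sum (f := fun τ => Y τ ω i j)
    (fun τ h => (hr.assignment (Finset.mem_Icc.1 h).1 ω).nonneg i j)
    (Finset.mem_Icc.2 ⟨hτ.1, hτ.2.trans ht⟩)

theorem measurable_pulls (hr : IsUCBRun P S φ V δ ℱ Y M γ Q) (t : ℕ) (i : Fin n) (j : Fin m) :
    Measurable fun ω => pulls Y t ω i j :=
  Finset.measurable_sum _ fun _ h => measurable_entry (hr.measurable_Y (Finset.mem_Icc.1 h).1) i j

theorem measurable_empMean (hr : IsUCBRun P S φ V δ ℱ Y M γ Q) (hS : IsLinkProcess P q S)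
    (t : ℕ) (i : Fin n) (j : Fin m) : Measurable fun ω => empMean S Y t ω i j :=
  (Finset.measurable_sum _ fun _ h =>
    (measurable_entry (hr.measurable_Y (Finset.mem_Icc.1 h).1) i j).mul
      (measurable_entry (hS.meas _ (Finset.mem_Icc.1 h).1) i j)).div (hr.measurable_pulls t i j)

theorem measurable_confWidth (hr : IsUCBRun P S φ V δ ℱ Y M γ Q) (t : ℕ) (i : Fin n)
    (j : Fin m) : Measurable fun ω => confWidth δ Y t ω i j := by
  have := hr.measurable_pulls t i j
  unfold confWidth
  fun_prop

end IsUCBRun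

end

/-! ### Concentration of the empirical success rates -/

section

variable {Ω : Type u} [MeasurableSpace Ω] {n m : ℕ} {P : Measure Ω} [IsProbabilityMeasure P]
  {q : Fin n → Fin m → ℝ} {S Y : ℕ → Ω → Fin n → Fin m → ℝ} {φ : (Fin n → ℝ) → ℝ} {B V : ℝ}
  {δ : ℕ → ℝ} {ℱ : Filtration ℕ ‹MeasurableSpace Ω›}
  {M : ℕ → Ω → Matrix (Fin (max n m)) (Fin (max n m)) ℝ} {γ Q : ℕ → Ω → Fin n → ℝ}

/-- Hoeffding's lemma for a link state. -/
theorem IsLinkProcess.integral_exp_le (hS : IsLinkProcess P q S) {t : ℕ} (ht : 1 ≤ t) (i : Fin n)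
    (j : Fin m) (l : ℝ) : ∫ ω, Real.exp (l * (S t ω i j - q i j) - l ^ 2 / 8) ∂P ≤ 1 := by
  have h := (hasSubgaussianMGF_of_mem_Icc (μ := P) (X := fun ω => S t ω i j) (a := 0) (b := 1)
    (measurable_entry (hS.meas t ht) i j).aemeasurable
    (Eventually.of_forall fun ω => by
      rcases hS.zero_one t ht ω i j with h | h <;> simp [h])).mgf_le l
  rw [hS.integral_eq ht] at h
  unfold mgf at h
  simp_rw [Real.exp_sub]
  rw [integral_div, div_le_one (Real.exp_pos _)]
  -- A variable with range in an interval of length 1 has variance proxy `1 / 4`, hence the exponent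
  -- `l ^ 2 / 8`.
  refine h.trans (le_of_eq ?_)
  congr 1
  simp
  ring

/-- The accumulated deviation of the observations of a link from their mean. -/
noncomputable def deviation (q : Fin n → Fin m → ℝ) (S Y : ℕ → Ω → Fin n → Fin m → ℝ) (t : ℕ)
    (ω : Ω) (i : Fin n) (j : Fin m) : ℝ :=
  ∑ τ ∈ Finset.Icc 1 t, (Y τ ω i j * S τ ω i j - q i j * Y τ ω i j)

namespace IsUCBRun

theorem measurable_exp_deviation (hr : IsUCBRun P S φ V δ ℱ Y M γ Q) (l : ℝ) (t : ℕ)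
    (i : Fin n) (j : Fin m) : Measurable[ℱ t] fun ω =>
      Real.exp (l * deviation q S Y t ω i j - l ^ 2 / 8 * pulls Y t ω i j) := by
  have hY : ∀ τ ∈ Finset.Icc 1 t, Measurable[ℱ t] fun ω => Y τ ω i j := by
    intro τ hτ
    rw [Finset.mem_Icc] at hτ
    obtain ⟨u, rfl⟩ := Nat.exists_eq_add_of_le' hτ.1
    exact (measurable_entry (hr.Y_meas u) i j).mono (ℱ.mono (by omega)) le_rfl
  have hYS : ∀ τ ∈ Finset.Icc 1 t, Measurable[ℱ t] fun ω => Y τ ω i j * S τ ω i j := by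
    intro τ hτ
    rw [Finset.mem_Icc] at hτ
    exact (measurable_entry (hr.feedback_meas τ hτ.1) i j).mono (ℱ.mono hτ.2) le_rfl
  have h1 : Measurable[ℱ t] fun ω => deviation q S Y t ω i j :=
    Finset.measurable_sum _ fun τ hτ => (hYS τ hτ).sub ((hY τ hτ).const_mul _)
  have h2 : Measurable[ℱ t] fun ω => pulls Y t ω i j := Finset.measurable_sum _ hY
  exact Real.measurable_exp.comp ((h1.const_mul _).sub (h2.const_mul _))

theorem integrable_exp_deviation (hr : IsUCBRun P S φ V δ ℱ Y M γ Q) (hS : IsLinkProcess P q S)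
    (l : ℝ) (t : ℕ) (i : Fin n) (j : Fin m) : Integrable (fun ω =>
      Real.exp (l * deviation q S Y t ω i j - l ^ 2 / 8 * pulls Y t ω i j)) P := by
  refine Integrable.of_bound
    ((hr.measurable_exp_deviation l t i j).mono (ℱ.le t) le_rfl).aestronglyMeasurable
    (Real.exp (|l| * t)) (Eventually.of_forall fun ω => ?_)
  rw [Real.norm_eq_abs, Real.abs_exp, Real.exp_le_exp]
  have hdev : |deviation q S Y t ω i j| ≤ t := by
    refine (Finset.abs_sum_le_sum_abs _ _).trans
      ((Finset.sum_le_sum fun τ hτ => (?_ : _ ≤ (1 : ℝ))).trans (by simp))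
    have h1 := (Finset.mem_Icc.1 hτ).1
    have hq := hS.prob_mem i j
    rw [abs_le]
    rcases (hr.assignment h1 ω).zero_one i j with h | h <;>
      rcases hS.zero_one τ h1 ω i j with h' | h' <;> rw [h, h'] <;>
      constructor <;> linarith [hq.1, hq.2]
  have hp : 0 ≤ pulls Y t ω i j := Finset.sum_nonneg fun τ hτ =>
    (hr.assignment (Finset.mem_Icc.1 hτ).1 ω).nonneg i j
  have h1 : l * deviation q S Y t ω i j ≤ |l| * t := by
    refine (le_abs_self _).trans ?_
    rw [abs_mul]
    gcongr
  have : 0 ≤ l ^ 2 / 8 * pulls Y t ω i j := by positivity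
  linarith

/-- The exponential supermartingale of a link. -/
theorem integral_exp_deviation_le (hr : IsUCBRun P S φ V δ ℱ Y M γ Q)
    (hS : IsLinkProcess P q S) (l : ℝ) (t : ℕ) (i : Fin n) (j : Fin m) :
    ∫ ω, Real.exp (l * deviation q S Y t ω i j - l ^ 2 / 8 * pulls Y t ω i j) ∂P ≤ 1 := by
  induction t with
  | zero => simp [deviation, pulls]
  | succ t ih =>
    set Z : Ω → ℝ := fun ω =>
      Real.exp (l * deviation q S Y t ω i j - l ^ 2 / 8 * pulls Y t ω i j) with hZ
    have hZm := hr.measurable_exp_deviation (q := q) l t i j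
    have hZi : Integrable Z P := hr.integrable_exp_deviation hS l t i j
    have hYm := measurable_entry (hr.Y_meas t) i j
    have hZY : Integrable (fun ω => Z ω * Y (t + 1) ω i j) P :=
      hZi.mul_bdd (c := 1) (hYm.mono (ℱ.le t) le_rfl).aestronglyMeasurable
        (Eventually.of_forall fun ω => by
          rcases (hr.assignment (by omega : 1 ≤ t + 1) ω).zero_one i j with h | h <;> simp [h])
    set h : ℝ → ℝ := fun x => Real.exp (l * (x - q i j) - l ^ 2 / 8) with hh
    have hhm : Measurable h := by fun_prop
    have hZYh : Integrable (fun ω => Z ω * Y (t + 1) ω i j * h (S (t + 1) ω i j)) P := by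
      refine hZY.mul_bdd (c := max |h 0| |h 1|)
        (hhm.comp (measurable_entry (hS.meas _ (by omega)) i j)).aestronglyMeasurable
        (Eventually.of_forall fun ω => ?_)
      rcases hS.zero_one (t + 1) (by omega) ω i j with h | h <;> simp [h]
    -- An unused link leaves the exponential unchanged, while a used one multiplies it by `h` of the
    -- new state. The decision to use it is known beforehand, so that factor can be integrated
    -- separately.
    have heq : ∀ ω, Real.exp (l * deviation q S Y (t + 1) ω i j -
        l ^ 2 / 8 * pulls Y (t + 1) ω i j) =
        (Z ω - Z ω * Y (t + 1) ω i j) + Z ω * Y (t + 1) ω i j * h (S (t + 1) ω i j) := by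
      intro ω
      simp only [hZ, hh, deviation, pulls]
      rw [Finset.sum_Icc_succ_top (by omega), Finset.sum_Icc_succ_top (by omega)]
      rcases (hr.assignment (by omega : 1 ≤ t + 1) ω).zero_one i j with h | h
      · simp [h]
      · rw [h, mul_one (Real.exp _), sub_self, zero_add, ← Real.exp_add]
        congr 1; ring
    simp_rw [heq]
    rw [integral_add (f := fun ω => Z ω - Z ω * Y (t + 1) ω i j) (hZi.sub hZY) hZYh, integral_sub hZi hZY,
      hr.integral_mul hS (W := fun ω => Z ω * Y (t + 1) ω i j) (hZm.mul hYm) hhm i j]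
    have h1 := hS.integral_exp_le (by omega : 1 ≤ t + 1) i j l
    have h2 : 0 ≤ ∫ ω, Z ω * Y (t + 1) ω i j ∂P := integral_nonneg fun ω =>
      mul_nonneg (Real.exp_pos _).le ((hr.assignment (by omega) ω).nonneg i j)
    have h3 := mul_le_mul_of_nonneg_left h1 h2
    rw [mul_one] at h3
    linarith [ih]

/-- Markov's inequality for the exponential supermartingale. The number of uses is random, so it is
fixed to `k` inside the event; the sign `e` covers both tails. -/
theorem prob_signed_deviation_le (hr : IsUCBRun P S φ V δ ℱ Y M γ Q) (hS : IsLinkProcess P q S)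
    (t k : ℕ) (i : Fin n) (j : Fin m) {a : ℝ} (ha : 0 ≤ a) {e : ℝ} (he : e = 1 ∨ e = -1) :
    P.real {ω | pulls Y t ω i j = k ∧ k * a ≤ e * deviation q S Y t ω i j} ≤
      Real.exp (-(2 * k * a ^ 2)) := by
  have he2 : e ^ 2 = 1 := by rcases he with h | h <;> simp [h]
  -- The tilt `l = 4 * a * e` maximizes the exponent: `4 * k * a ^ 2 - 2 * k * a ^ 2 = 2 * k * a ^
  -- 2`.
  have hi := hr.integrable_exp_deviation hS (4 * a * e) t i j
  have h1 := mul_meas_ge_le_integral_of_nonneg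
    (Eventually.of_forall fun ω => (Real.exp_pos _).le) hi (Real.exp (2 * k * a ^ 2))
  have h2 := h1.trans (hr.integral_exp_deviation_le hS (4 * a * e) t i j)
  have h3 : {ω | pulls Y t ω i j = k ∧ k * a ≤ e * deviation q S Y t ω i j} ⊆
      {ω | Real.exp (2 * k * a ^ 2) ≤ Real.exp (4 * a * e * deviation q S Y t ω i j -
        (4 * a * e) ^ 2 / 8 * pulls Y t ω i j)} := by
    rintro ω ⟨h, h'⟩
    rw [Set.mem_ofPred_eq, Real.exp_le_exp, h, mul_pow, he2]
    nlinarith [mul_le_mul_of_nonneg_left h' ha]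
  rw [Real.exp_neg, ← one_div, le_div_iff₀' (Real.exp_pos _)]
  exact (mul_le_mul_of_nonneg_left (measureReal_mono h3) (Real.exp_pos _).le).trans h2

theorem empMean_sub (hr : IsUCBRun P S φ V δ ℱ Y M γ Q) {t : ℕ} (ht : max n m ≤ t) (ω : Ω)
    (i : Fin n) (j : Fin m) :
    pulls Y t ω i j * (empMean S Y t ω i j - q i j) = deviation q S Y t ω i j := by
  have h := hr.one_le_pulls ht ω i j
  have h0 : pulls Y t ω i j ≠ 0 := by positivity
  unfold empMean deviation
  rw [mul_sub, mul_div_cancel₀ _ h0, Finset.sum_sub_distrib, ← Finset.mul_sum, mul_comm (q i j)]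
  rfl

/-- The confidence interval of a link fails with probability at most `2 δ t`. -/
theorem prob_confidence_fails (hr : IsUCBRun P S φ V δ ℱ Y M γ Q) (hS : IsLinkProcess P q S)
    {t : ℕ} (ht : max n m ≤ t) (hδ : 0 < δ t) (i : Fin n) (j : Fin m) :
    P.real {ω | confWidth δ Y t ω i j < |empMean S Y t ω i j - q i j|} ≤ 2 * δ t := by
  let f : ℕ → ℝ := fun k => √(Real.log (k * (k + 1) / δ t) / (2 * k))
  let E : ℝ → ℕ → Set Ω := fun e k =>
    {ω | pulls Y t ω i j = k ∧ k * f k ≤ e * deviation q S Y t ω i j}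
  -- Split by the number `k` of uses, which lies between 1 and `t`, and by the sign of the
  -- deviation; for fixed `k` the width is the constant `f k`.
  have hsub : {ω | confWidth δ Y t ω i j < |empMean S Y t ω i j - q i j|} ⊆
      ⋃ k ∈ Finset.Icc 1 t, (E 1 k ∪ E (-1) k) := by
    intro ω hω
    obtain ⟨k, hk, hkt⟩ := hr.exists_pulls_eq t ω i j
    have h1 := hr.one_le_pulls ht ω i j
    have hd := hr.empMean_sub (q := q) ht ω i j
    rw [hk] at h1 hd
    change confWidth δ Y t ω i j < _ at hω
    unfold confWidth at hω
    rw [hk] at hω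
    have hk1 : 1 ≤ k := by exact_mod_cast h1
    have h2 : k * f k ≤ |deviation q S Y t ω i j| := by
      rw [← hd, abs_mul, Nat.abs_cast]
      gcongr
    simp only [Set.mem_iUnion]
    refine ⟨k, Finset.mem_Icc.2 ⟨hk1, hkt⟩, ?_⟩
    rcases le_abs.1 h2 with h | h
    · left; exact ⟨hk, by rwa [one_mul]⟩
    · right; exact ⟨hk, by rwa [neg_one_mul]⟩
  have hE : ∀ k ∈ Finset.Icc 1 t, P.real (E 1 k ∪ E (-1) k) ≤
      2 * δ t * (1 / k - 1 / (k + 1)) := by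
    intro k hk
    have hk0 : (0 : ℝ) < k := by exact_mod_cast (Finset.mem_Icc.1 hk).1
    have hexp : Real.exp (-(2 * k * f k ^ 2)) ≤ δ t / (k * (k + 1)) := by
      have hpos : 0 < k * (k + 1) / δ t := by positivity
      -- Only an inequality: for a negative logarithm the square root is 0 and still dominates.
      have hf : Real.log (k * (k + 1) / δ t) / (2 * k) ≤ f k ^ 2 := by
        rcases le_total 0 (Real.log (k * (k + 1) / δ t) / (2 * k)) with h | h
        · exact (Real.sq_sqrt h).ge
        · exact h.trans (sq_nonneg _)
      rw [div_le_iff₀ (by positivity)] at hf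
      calc Real.exp (-(2 * k * f k ^ 2)) ≤ Real.exp (-Real.log (k * (k + 1) / δ t)) := by
            rw [Real.exp_le_exp]; linarith
        _ = δ t / (k * (k + 1)) := by rw [Real.exp_neg, Real.exp_log hpos, inv_div]
    have h1 := hr.prob_signed_deviation_le hS t k i j (Real.sqrt_nonneg _ : 0 ≤ f k) (.inl rfl)
    have h2 := hr.prob_signed_deviation_le hS t k i j (Real.sqrt_nonneg _ : 0 ≤ f k) (.inr rfl)
    have h3 : 2 * δ t * (1 / k - 1 / (k + 1)) = 2 * (δ t / (k * (k + 1))) := by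
      field_simp; ring
    rw [h3]
    exact (measureReal_union_le _ _).trans (by linarith [h1.trans hexp, h2.trans hexp])
  -- The factor `k * (k + 1)` in the width makes the union bound telescope, so it costs nothing
  -- beyond the two tails.
  have htel : ∀ t : ℕ, ∑ k ∈ Finset.Icc 1 t, (1 / (k : ℝ) - 1 / (k + 1)) = 1 - 1 / (t + 1) := by
    intro t
    induction t with
    | zero => simp
    | succ t ih => rw [Finset.sum_Icc_succ_top (by omega), ih]; push_cast; ring
  calc P.real {ω | confWidth δ Y t ω i j < |empMean S Y t ω i j - q i j|}
      ≤ P.real (⋃ k ∈ Finset.Icc 1 t, (E 1 k ∪ E (-1) k)) := measureReal_mono hsub (measure_ne_top _ _)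
    _ ≤ ∑ k ∈ Finset.Icc 1 t, P.real (E 1 k ∪ E (-1) k) := measureReal_biUnion_finset_le _ _
    _ ≤ ∑ k ∈ Finset.Icc 1 t, 2 * δ t * (1 / (k : ℝ) - 1 / (k + 1)) := Finset.sum_le_sum hE
    _ = 2 * δ t * (1 - 1 / (t + 1)) := by rw [← Finset.mul_sum, htel]
    _ ≤ 2 * δ t * 1 := by
        gcongr
        have : (0 : ℝ) ≤ 1 / (t + 1) := by positivity
        linarith
    _ = 2 * δ t := mul_one _

end IsUCBRun

/-- The number of links whose confidence interval fails at the end of slot `t`. -/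
noncomputable def failures (q : Fin n → Fin m → ℝ) (δ : ℕ → ℝ) (S Y : ℕ → Ω → Fin n → Fin m → ℝ)
    (t : ℕ) (ω : Ω) : ℝ :=
  ∑ i, ∑ j, Set.indicator {ω | confWidth δ Y t ω i j < |empMean S Y t ω i j - q i j|} 1 ω

namespace IsUCBRun

theorem integrable_failure (hr : IsUCBRun P S φ V δ ℱ Y M γ Q) (hS : IsLinkProcess P q S)
    (t : ℕ) (i : Fin n) (j : Fin m) : Integrable (Set.indicator
      {ω | confWidth δ Y t ω i j < |empMean S Y t ω i j - q i j|} (1 : Ω → ℝ)) P :=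
  (integrable_const (1 : ℝ)).indicator (measurableSet_lt (hr.measurable_confWidth t i j)
    ((hr.measurable_empMean hS t i j).sub_const _).abs)

theorem integrable_failures (hr : IsUCBRun P S φ V δ ℱ Y M γ Q) (hS : IsLinkProcess P q S)
    (t : ℕ) : Integrable (failures q δ S Y t) P :=
  integrable_finsetSum _ fun i _ => integrable_finsetSum _ fun j _ => hr.integrable_failure hS t i j

theorem integral_failures_le (hr : IsUCBRun P S φ V δ ℱ Y M γ Q) (hS : IsLinkProcess P q S)
    {t : ℕ} (ht : max n m ≤ t) (hδ : 0 < δ t) :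
    ∫ ω, failures q δ S Y t ω ∂P ≤ 2 * n * m * δ t := by
  unfold failures
  rw [integral_finsetSum _ fun i _ => integrable_finsetSum _ fun j _ =>
    hr.integrable_failure hS t i j]
  have h : ∀ i, ∫ ω, ∑ j, Set.indicator
      {ω | confWidth δ Y t ω i j < |empMean S Y t ω i j - q i j|} (1 : Ω → ℝ) ω ∂P ≤
      m * (2 * δ t) := by
    intro i
    rw [integral_finsetSum _ fun j _ => hr.integrable_failure hS t i j]
    refine (Finset.sum_le_sum fun j _ => (?_ : _ ≤ 2 * δ t)).trans (by simp)
    rw [integral_indicator_one (measurableSet_lt (hr.measurable_confWidth t i j)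
      ((hr.measurable_empMean hS t i j).sub_const _).abs)]
    exact hr.prob_confidence_fails hS ht hδ i j
  refine (Finset.sum_le_sum fun i _ => h i).trans (le_of_eq ?_)
  rw [Finset.sum_const, Finset.card_univ, Fintype.card_fin, nsmul_eq_mul]
  ring

/-! ### Max-weight matching and drift-plus-penalty -/

/-- The max-weight choice of the links is nearly as good as any fractional assignment. -/
theorem weight_gap (hr : IsUCBRun P S φ V δ ℱ Y M γ Q) (hS : IsLinkProcess P q S) (hV : 0 < V)
    (hB : 0 ≤ B) (hφ : IsUtility φ B) {y : Fin n → Fin m → ℝ} (hy : IsFractional y)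
    (hx : (fun i => ∑ j, q i j * y i j) ∈ cube n) {t : ℕ} (ht : max n m ≤ t) (ω : Ω) :
    ∑ i, Q (t + 1) ω i * ∑ j, q i j * y i j ≤
      ∑ i, ∑ j, q i j * (Q (t + 1) ω i * Y (t + 1) ω i j)
      + 2 * (B * V + 1) * ∑ i, ∑ j, Y (t + 1) ω i j * confWidth δ Y t ω i j
      + n * (B * V + 1) * failures q δ S Y t ω := by
  have hlt : max n m < t + 1 := Nat.lt_succ_of_le ht
  have hQ0 := hr.Q_nonneg hlt ω
  have hQ1 := hr.Q_le hS hV hB hφ hlt ω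
  have hY := hr.assignment (by omega : 1 ≤ t + 1) ω
  have hBV : 0 ≤ B * V + 1 := by positivity
  have hf0 : ∀ i j, 0 ≤ confWidth δ Y t ω i j := fun i j => Real.sqrt_nonneg _
  have hfail0 : ∀ i j, 0 ≤ Set.indicator
      {ω | confWidth δ Y t ω i j < |empMean S Y t ω i j - q i j|} (1 : Ω → ℝ) ω :=
    fun i j => Set.indicator_nonneg (fun _ _ => zero_le_one) _
  by_cases hgood : ∀ i j, |empMean S Y t ω i j - q i j| ≤ confWidth δ Y t ω i j
  · have hU : ∀ i j, q i j ≤ ucb δ S Y t ω i j ∧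
        ucb δ S Y t ω i j ≤ q i j + 2 * confWidth δ Y t ω i j := by
      intro i j
      have := abs_le.1 (hgood i j)
      unfold ucb
      constructor <;> linarith
    have hmax := hr.M_max (t + 1) hlt ω
    rw [Nat.add_sub_cancel] at hmax
    -- Optimism: it suffices to test assignments `a`. Replacing `q` by the larger `ucb` raises their
    -- weight, and some permutation matrix, which competes with `M`, dominates `a`.
    have h1 : ∑ i, ∑ j, Q (t + 1) ω i * q i j * y i j ≤
        weight (Q (t + 1) ω) (ucb δ S Y t ω) (M (t + 1) ω) := by
      refine hy _ _ fun a ha => ?_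
      obtain ⟨A, hA, hle⟩ := ha.exists_weight_ge hQ0
        (fun i j => (hS.prob_mem i j).1.trans (hU i j).1)
      refine le_trans ?_ (hle.trans (hmax hA))
      gcongr with i _ j _
      · exact ha.nonneg i j
      · exact hQ0 i
      · exact (hU i j).1
    have h2 : weight (Q (t + 1) ω) (ucb δ S Y t ω) (M (t + 1) ω) ≤
        ∑ i, ∑ j, (q i j * (Q (t + 1) ω i * Y (t + 1) ω i j) +
          2 * (B * V + 1) * (Y (t + 1) ω i j * confWidth δ Y t ω i j)) := by
      unfold weight
      refine Finset.sum_le_sum fun i _ => Finset.sum_le_sum fun j _ => ?_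
      rw [← hr.Y_eq (t + 1) hlt ω i j]
      have e1 := mul_le_mul_of_nonneg_left (hU i j).2 (mul_nonneg (hQ0 i) (hY.nonneg i j))
      have e2 := mul_le_mul_of_nonneg_right (hQ1 i) (mul_nonneg (hY.nonneg i j) (hf0 i j))
      linarith
    have h3 : 0 ≤ failures q δ S Y t ω :=
      Finset.sum_nonneg fun i _ => Finset.sum_nonneg fun j _ => hfail0 i j
    have h4 := mul_nonneg (mul_nonneg (Nat.cast_nonneg' n) hBV) h3
    have h5 : ∑ i, Q (t + 1) ω i * ∑ j, q i j * y i j =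
        ∑ i, ∑ j, Q (t + 1) ω i * q i j * y i j := by
      simp_rw [Finset.mul_sum, mul_assoc]
    simp only [Finset.sum_add_distrib, ← Finset.mul_sum] at h2
    linarith
  -- Some interval fails, so the failure count is at least 1 and its term alone covers the trivial
  -- bound `n * (B * V + 1)` on the left side.
  · push Not at hgood
    obtain ⟨i₀, j₀, h0⟩ := hgood
    have h1 : 1 ≤ failures q δ S Y t ω := by
      calc (1 : ℝ) = Set.indicator {ω | confWidth δ Y t ω i₀ j₀ <
            |empMean S Y t ω i₀ j₀ - q i₀ j₀|} (1 : Ω → ℝ) ω := by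
            rw [Set.indicator_of_mem (by exact h0)]; rfl
        _ ≤ _ := Finset.single_le_sum (f := fun j => Set.indicator {ω | confWidth δ Y t ω i₀ j <
            |empMean S Y t ω i₀ j - q i₀ j|} (1 : Ω → ℝ) ω) (fun j _ => hfail0 i₀ j)
            (Finset.mem_univ j₀)
        _ ≤ _ := Finset.single_le_sum (f := fun i => ∑ j, Set.indicator {ω |
            confWidth δ Y t ω i j < |empMean S Y t ω i j - q i j|} (1 : Ω → ℝ) ω)
            (fun i _ => Finset.sum_nonneg fun j _ => hfail0 i j) (Finset.mem_univ i₀)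
    have h2 : ∑ i, Q (t + 1) ω i * ∑ j, q i j * y i j ≤ n * (B * V + 1) := by
      refine (Finset.sum_le_sum fun i _ => (?_ : _ ≤ B * V + 1)).trans (by simp [mul_add])
      exact (mul_le_of_le_one_right (hQ0 i) (hx.2 i)).trans (hQ1 i)
    have h3 : 0 ≤ ∑ i, ∑ j, q i j * (Q (t + 1) ω i * Y (t + 1) ω i j) :=
      Finset.sum_nonneg fun i _ => Finset.sum_nonneg fun j _ =>
        mul_nonneg (hS.prob_mem i j).1 (mul_nonneg (hQ0 i) (hY.nonneg i j))
    have h4 : 0 ≤ ∑ i, ∑ j, Y (t + 1) ω i j * confWidth δ Y t ω i j :=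
      Finset.sum_nonneg fun i _ => Finset.sum_nonneg fun j _ => mul_nonneg (hY.nonneg i j) (hf0 i j)
    have h5 := mul_le_mul_of_nonneg_left h1 (mul_nonneg (Nat.cast_nonneg' (α := ℝ) n) hBV)
    have h6 := mul_nonneg (mul_nonneg (zero_le_two (α := ℝ)) hBV) h4
    linarith

/-- The drift-plus-penalty inequality, with the utility of `γ t` replaced by its linearization. -/
theorem drift_le (hr : IsUCBRun P S φ V δ ℱ Y M γ Q) (hS : IsLinkProcess P q S) (hV : 0 < V)
    {x c g : Fin n → ℝ} (hx : x ∈ cube n)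
    (hg : ∀ z ∈ cube n, φ z ≤ φ c + ∑ i, g i * (z i - c i)) {t : ℕ} (ht : max n m < t) (ω : Ω) :
    (∑ i, Q (t + 1) ω i ^ 2) / 2 - (∑ i, Q t ω i ^ 2) / 2 ≤
      n / 2 + V * (φ c - φ x) + V * ∑ i, g i * (γ t ω i - c i)
      + (∑ i, Q t ω i * x i - ∑ i, Q t ω i * success S Y t ω i) := by
  have hγ := hr.γ_mem t ht ω
  have hmin := hr.γ_min t ht ω hx
  simp only [Set.mem_ofPred_eq] at hmin
  have hlin := mul_le_mul_of_nonneg_left (hg _ hγ) hV.le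
  have hsq : ∑ i, Q (t + 1) ω i ^ 2 ≤ ∑ i, (Q t ω i ^ 2 + 1 +
      2 * (Q t ω i * γ t ω i) - 2 * (Q t ω i * success S Y t ω i)) := by
    refine Finset.sum_le_sum fun i _ => ?_
    have hX := success_mem hS (by omega : 1 ≤ t) (hr.assignment (by omega) ω) i
    have h0 := hγ.1 i
    have h1 := hγ.2 i
    rw [Pi.zero_apply] at h0
    rw [Pi.one_apply] at h1
    rw [hr.Q_step t ht ω i]
    have e1 : max (Q t ω i + γ t ω i - success S Y t ω i) 0 ^ 2 ≤
        (Q t ω i + γ t ω i - success S Y t ω i) ^ 2 := by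
      rw [sq_le_sq, abs_of_nonneg (le_max_right _ _)]
      exact max_le (le_abs_self _) (abs_nonneg _)
    -- Arrivals and services both lie in `[0,1]`; these squares, halved and summed over the users,
    -- give `n / 2`.
    have e2 : (γ t ω i - success S Y t ω i) ^ 2 ≤ 1 := by
      rw [sq_le_one_iff_abs_le_one, abs_le]
      constructor <;> linarith [hX.1, hX.2]
    linarith
  simp only [Finset.sum_add_distrib, Finset.sum_sub_distrib, ← Finset.mul_sum, Finset.sum_const,
    Finset.card_univ, Fintype.card_fin, nsmul_eq_mul, mul_one] at hsq
  linarith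

theorem integrable_γ (hr : IsUCBRun P S φ V δ ℱ Y M γ Q) {t : ℕ} (ht : max n m < t) (i : Fin n) :
    Integrable (fun ω => γ t ω i) P := by
  obtain ⟨u, rfl⟩ := Nat.exists_eq_add_of_lt ht
  have hm := (measurable_pi_apply i).comp (hr.γ_meas (max n m + u) (by omega))
  refine Integrable.of_bound (hm.mono (ℱ.le _) le_rfl).aestronglyMeasurable 1
    (Eventually.of_forall fun ω => ?_)
  rw [Real.norm_eq_abs, abs_of_nonneg ((hr.γ_mem _ ht ω).1 i)]
  exact (hr.γ_mem _ ht ω).2 i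

theorem integrable_Q_pow (hr : IsUCBRun P S φ V δ ℱ Y M γ Q) (hS : IsLinkProcess P q S)
    (hV : 0 < V) (hB : 0 ≤ B) (hφ : IsUtility φ B) {t : ℕ} (ht : max n m < t) (i : Fin n)
    (k : ℕ) : Integrable (fun ω => Q t ω i ^ k) P := by
  obtain ⟨u, rfl⟩ := Nat.exists_eq_add_of_lt ht
  have hm := (hr.measurable_Q (t := max n m + u) (by omega) i).mono (ℱ.le _) le_rfl
  refine Integrable.of_bound (hm.pow_const k).aestronglyMeasurable ((B * V + 1) ^ k)
    (Eventually.of_forall fun ω => ?_)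
  have h0 := hr.Q_nonneg ht ω i
  rw [norm_pow, Real.norm_eq_abs, abs_of_nonneg h0]
  exact pow_le_pow_left₀ h0 (hr.Q_le hS hV hB hφ ht ω i) k

theorem integrable_Q (hr : IsUCBRun P S φ V δ ℱ Y M γ Q) (hS : IsLinkProcess P q S)
    (hV : 0 < V) (hB : 0 ≤ B) (hφ : IsUtility φ B) {t : ℕ} (ht : max n m < t) (i : Fin n) :
    Integrable (fun ω => Q t ω i) P := by
  simpa using hr.integrable_Q_pow hS hV hB hφ ht i 1

theorem integrable_mul_Y (hr : IsUCBRun P S φ V δ ℱ Y M γ Q) {f : Ω → ℝ} (hf : Integrable f P)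
    {t : ℕ} (ht : 1 ≤ t) (i : Fin n) (j : Fin m) : Integrable (fun ω => f ω * Y t ω i j) P :=
  hf.mul_bdd (c := 1) (measurable_entry (hr.measurable_Y ht) i j).aestronglyMeasurable
    (Eventually.of_forall fun ω => by
      rcases (hr.assignment ht ω).zero_one i j with h | h <;> simp [h])

theorem integrable_confWidth (hr : IsUCBRun P S φ V δ ℱ Y M γ Q) (t : ℕ) (i : Fin n)
    (j : Fin m) : Integrable (fun ω => confWidth δ Y t ω i j) P := by
  refine Integrable.of_bound (hr.measurable_confWidth t i j).aestronglyMeasurable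
    -- The number of uses takes only the values `0, …, t`, so the sum of all possible widths is a
    -- deterministic bound.
    (∑ k ∈ Finset.range (t + 1), √(Real.log (k * (k + 1) / δ t) / (2 * k)))
    (Eventually.of_forall fun ω => ?_)
  obtain ⟨k, hk, hkt⟩ := hr.exists_pulls_eq t ω i j
  unfold confWidth
  rw [Real.norm_eq_abs, abs_of_nonneg (Real.sqrt_nonneg _), hk]
  exact Finset.single_le_sum (f := fun k : ℕ => √(Real.log (k * (k + 1) / δ t) / (2 * k)))
    (fun _ _ => Real.sqrt_nonneg _) (Finset.mem_range.2 (Nat.lt_succ_of_le hkt))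

theorem integrable_Y_mul_confWidth (hr : IsUCBRun P S φ V δ ℱ Y M γ Q) {t : ℕ} (ht : 1 ≤ t)
    (u : ℕ) (i : Fin n) (j : Fin m) :
    Integrable (fun ω => Y t ω i j * confWidth δ Y u ω i j) P := by
  simpa [mul_comm] using hr.integrable_mul_Y (hr.integrable_confWidth u i j) ht i j

theorem integrable_Q_mul_success (hr : IsUCBRun P S φ V δ ℱ Y M γ Q) (hS : IsLinkProcess P q S)
    (hV : 0 < V) (hB : 0 ≤ B) (hφ : IsUtility φ B) {t : ℕ} (ht : max n m < t) (i : Fin n) :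
    Integrable (fun ω => Q t ω i * success S Y t ω i) P := by
  simp only [success, Finset.mul_sum, ← mul_assoc]
  exact integrable_finsetSum _ fun j _ => hS.integrable_mul (by omega)
    (hr.integrable_mul_Y (hr.integrable_Q hS hV hB hφ ht i) (by omega) i j) i j

theorem integral_Q_mul_success (hr : IsUCBRun P S φ V δ ℱ Y M γ Q) (hS : IsLinkProcess P q S)
    (hV : 0 < V) (hB : 0 ≤ B) (hφ : IsUtility φ B) {t : ℕ} (ht : max n m ≤ t) (i : Fin n) :
    ∫ ω, Q (t + 1) ω i * success S Y (t + 1) ω i ∂P =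
      ∑ j, q i j * ∫ ω, Q (t + 1) ω i * Y (t + 1) ω i j ∂P := by
  have hlt : max n m < t + 1 := Nat.lt_succ_of_le ht
  simp only [success, Finset.mul_sum, ← mul_assoc]
  rw [integral_finsetSum _ fun j _ => hS.integrable_mul (by omega)
    (hr.integrable_mul_Y (hr.integrable_Q hS hV hB hφ hlt i) (by omega) i j) i j]
  refine Finset.sum_congr rfl fun j _ => ?_
  rw [hr.integral_mul hS (W := fun ω => Q (t + 1) ω i * Y (t + 1) ω i j)
    ((hr.measurable_Q ht i).mul (measurable_entry (hr.Y_meas t) i j)) (h := fun x => x)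
    measurable_id i j, hS.integral_eq (by omega), mul_comm]

/-- The expectation of the drift in one slot. -/
theorem expected_drift_le (hr : IsUCBRun P S φ V δ ℱ Y M γ Q) (hS : IsLinkProcess P q S)
    (hV : 0 < V) (hB : 0 ≤ B) (hφ : IsUtility φ B) {y : Fin n → Fin m → ℝ} (hy : IsFractional y)
    (hx : (fun i => ∑ j, q i j * y i j) ∈ cube n) {c g : Fin n → ℝ}
    (hg : ∀ z ∈ cube n, φ z ≤ φ c + ∑ i, g i * (z i - c i)) {t : ℕ} (ht : max n m ≤ t)
    (hδ : 0 < δ t) :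
    (∫ ω, (∑ i, Q (t + 1 + 1) ω i ^ 2) / 2 ∂P) - ∫ ω, (∑ i, Q (t + 1) ω i ^ 2) / 2 ∂P ≤
      n / 2 + V * (φ c - φ (fun i => ∑ j, q i j * y i j))
      + V * ∑ i, g i * ((∫ ω, γ (t + 1) ω i ∂P) - c i)
      + 2 * (B * V + 1) * ∑ i, ∑ j, ∫ ω, Y (t + 1) ω i j * confWidth δ Y t ω i j ∂P
      + n * (B * V + 1) * (2 * n * m * δ t) := by
  have hlt : max n m < t + 1 := Nat.lt_succ_of_le ht
  have h1 : 1 ≤ t + 1 := by omega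
  have hBV : 0 ≤ B * V + 1 := by positivity
  have iQ := fun i => hr.integrable_Q hS hV hB hφ hlt i
  have isq : ∀ u, max n m < u → Integrable (fun ω => (∑ i, Q u ω i ^ 2) / 2) P := fun u hu =>
    (integrable_finsetSum _ fun i _ => hr.integrable_Q_pow hS hV hB hφ hu i 2).div_const 2
  have iγi : ∀ i, Integrable (fun ω => g i * (γ (t + 1) ω i - c i)) P := fun i =>
    ((hr.integrable_γ hlt i).sub (integrable_const (c i))).const_mul (g i)
  have iγ : Integrable (fun ω => V * ∑ i, g i * (γ (t + 1) ω i - c i)) P :=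
    (integrable_finsetSum _ fun i _ => iγi i).const_mul V
  have iQY := fun i j => hr.integrable_mul_Y (iQ i) h1 i j
  have iqQY : Integrable (fun ω => ∑ i, ∑ j, q i j * (Q (t + 1) ω i * Y (t + 1) ω i j)) P :=
    integrable_finsetSum _ fun i _ => integrable_finsetSum _ fun j _ => (iQY i j).const_mul _
  have iQX : Integrable (fun ω => ∑ i, Q (t + 1) ω i * success S Y (t + 1) ω i) P :=
    integrable_finsetSum _ fun i _ => hr.integrable_Q_mul_success hS hV hB hφ hlt i
  have iYf : Integrable (fun ω =>
      2 * (B * V + 1) * ∑ i, ∑ j, Y (t + 1) ω i j * confWidth δ Y t ω i j) P :=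
    (integrable_finsetSum _ fun i _ => integrable_finsetSum _ fun j _ =>
      hr.integrable_Y_mul_confWidth h1 t i j).const_mul _
  have iF : Integrable (fun ω => n * (B * V + 1) * failures q δ S Y t ω) P :=
    (hr.integrable_failures hS t).const_mul _
  have hpath : ∀ ω, (∑ i, Q (t + 1 + 1) ω i ^ 2) / 2 - (∑ i, Q (t + 1) ω i ^ 2) / 2 ≤
      (n / 2 + V * (φ c - φ (fun i => ∑ j, q i j * y i j)))
      + V * ∑ i, g i * (γ (t + 1) ω i - c i)
      + (∑ i, ∑ j, q i j * (Q (t + 1) ω i * Y (t + 1) ω i j)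
        - ∑ i, Q (t + 1) ω i * success S Y (t + 1) ω i)
      + 2 * (B * V + 1) * ∑ i, ∑ j, Y (t + 1) ω i j * confWidth δ Y t ω i j
      + n * (B * V + 1) * failures q δ S Y t ω := by
    intro ω
    have e1 := hr.drift_le hS hV hx hg hlt ω
    have e2 := hr.weight_gap hS hV hB hφ hy hx ht ω
    linarith
  have hint := integral_mono ((isq _ (by omega)).sub (isq _ hlt))
    (((((integrable_const _).add iγ).add (iqQY.sub iQX)).add iYf).add iF) hpath
  rw [integral_sub' (isq _ (by omega)) (isq _ hlt)] at hint
  refine hint.trans ?_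
  rw [integral_add' ((((integrable_const _).add iγ).add (iqQY.sub iQX)).add iYf) iF,
    integral_add' (((integrable_const _).add iγ).add (iqQY.sub iQX)) iYf,
    integral_add' ((integrable_const _).add iγ) (iqQY.sub iQX),
    integral_add' (integrable_const _) iγ, integral_sub' iqQY iQX, integral_const_mul,
    integral_const_mul, integral_const_mul, integral_const]
  have eγ : ∫ ω, ∑ i, g i * (γ (t + 1) ω i - c i) ∂P =
      ∑ i, g i * ((∫ ω, γ (t + 1) ω i ∂P) - c i) := by
    rw [integral_finsetSum _ fun i _ => iγi i]
    refine Finset.sum_congr rfl fun i _ => ?_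
    rw [integral_const_mul, integral_sub (hr.integrable_γ hlt i) (integrable_const _)]
    simp
  -- Queue and assignment are known before the slot's link states, so each state averages to `q`;
  -- the success term cancels against the one from `weight_gap`.
  have eX : ∫ ω, ∑ i, Q (t + 1) ω i * success S Y (t + 1) ω i ∂P =
      ∫ ω, ∑ i, ∑ j, q i j * (Q (t + 1) ω i * Y (t + 1) ω i j) ∂P := by
    rw [integral_finsetSum _ fun i _ => hr.integrable_Q_mul_success hS hV hB hφ hlt i,
      integral_finsetSum _ fun i _ => integrable_finsetSum _ fun j _ => (iQY i j).const_mul _]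
    refine Finset.sum_congr rfl fun i _ => ?_
    rw [hr.integral_Q_mul_success hS hV hB hφ ht i,
      integral_finsetSum _ fun j _ => (iQY i j).const_mul _]
    exact Finset.sum_congr rfl fun j _ => (integral_const_mul _ _).symm
  have eY : ∫ ω, ∑ i, ∑ j, Y (t + 1) ω i j * confWidth δ Y t ω i j ∂P =
      ∑ i, ∑ j, ∫ ω, Y (t + 1) ω i j * confWidth δ Y t ω i j ∂P := by
    rw [integral_finsetSum _ fun i _ => integrable_finsetSum _ fun j _ =>
      hr.integrable_Y_mul_confWidth h1 t i j]
    exact Finset.sum_congr rfl fun i _ =>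
      integral_finsetSum _ fun j _ => hr.integrable_Y_mul_confWidth h1 t i j
  have hF := mul_le_mul_of_nonneg_left (hr.integral_failures_le hS ht hδ)
    (mul_nonneg (Nat.cast_nonneg' (α := ℝ) n) hBV)
  rw [eγ, eX, eY]
  simp only [probReal_univ, one_smul]
  linarith

/-- The sum of the expected drifts, over the slots after the exploration phase. -/
theorem sum_drift_le (hr : IsUCBRun P S φ V δ ℱ Y M γ Q) (hS : IsLinkProcess P q S)
    (hV : 0 < V) (hB : 0 ≤ B) (hφ : IsUtility φ B) {y : Fin n → Fin m → ℝ} (hy : IsFractional y)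
    (hx : (fun i => ∑ j, q i j * y i j) ∈ cube n) {c g : Fin n → ℝ}
    (hg : ∀ z ∈ cube n, φ z ≤ φ c + ∑ i, g i * (z i - c i))
    (hδ : ∀ t, max n m ≤ t → 0 < δ t) {T : ℕ} (hT : max n m ≤ T) :
    0 ≤ ∑ t ∈ Finset.Icc (max n m + 1) T,
      (n / 2 + V * (φ c - φ (fun i => ∑ j, q i j * y i j))
      + V * ∑ i, g i * ((∫ ω, γ t ω i ∂P) - c i)
      + 2 * (B * V + 1) * ∑ i, ∑ j, ∫ ω, Y t ω i j * confWidth δ Y (t - 1) ω i j ∂P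
      + n * (B * V + 1) * (2 * n * m * δ (t - 1))) := by
  -- The induction proves the stronger claim that the drifts dominate the final quadratic energy,
  -- which starts at 0.
  refine le_trans (b := ∫ ω, (∑ i, Q (T + 1) ω i ^ 2) / 2 ∂P)
    (integral_nonneg fun ω => by positivity) ?_
  induction T, hT using Nat.le_induction with
  | base => simp [hr.Q_init]
  | succ T hT ih =>
    rw [Finset.sum_Icc_succ_top (by omega), Nat.add_sub_cancel]
    have := hr.expected_drift_le hS hV hB hφ hy hx hg hT (hδ T hT)
    linarith

/-- The queue recursion dominates the running sum of arrivals minus services, and the queue itself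
is bounded. -/
theorem sum_γ_sub_success_le (hr : IsUCBRun P S φ V δ ℱ Y M γ Q) (hS : IsLinkProcess P q S)
    (hV : 0 < V) (hB : 0 ≤ B) (hφ : IsUtility φ B) {T : ℕ} (hT : max n m ≤ T) (i : Fin n) :
    ∑ t ∈ Finset.Icc (max n m + 1) T, ((∫ ω, γ t ω i ∂P) - ∫ ω, success S Y t ω i ∂P) ≤
      B * V + 1 := by
  have h : ∑ t ∈ Finset.Icc (max n m + 1) T,
      ((∫ ω, γ t ω i ∂P) - ∫ ω, success S Y t ω i ∂P) ≤ ∫ ω, Q (T + 1) ω i ∂P := by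
    induction T, hT using Nat.le_induction with
    | base => simp [hr.Q_init]
    | succ T hT ih =>
      rw [Finset.sum_Icc_succ_top (by omega)]
      have hlt : max n m < T + 1 := by omega
      have iX := hS.integrable_success (by omega : 1 ≤ T + 1) (hr.measurable_Y (by omega))
        (hr.assignment (by omega)) i
      have iQ := hr.integrable_Q hS hV hB hφ hlt i
      have iγ := hr.integrable_γ hlt i
      have := integral_mono ((iQ.add iγ).sub iX)
        (hr.integrable_Q hS hV hB hφ (t := T + 1 + 1) (by omega) i) fun ω => by
          change Q (T + 1) ω i + γ (T + 1) ω i - success S Y (T + 1) ω i ≤ _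
          rw [hr.Q_step (T + 1) hlt ω i]
          exact le_max_left _ _
      rw [integral_sub' (iQ.add iγ) iX, integral_add' iQ iγ] at this
      linarith
  refine h.trans ((integral_mono (hr.integrable_Q hS hV hB hφ (by omega) i)
    (integrable_const (B * V + 1)) fun ω => hr.Q_le hS hV hB hφ (by omega) ω i).trans ?_)
  simp

/-- The regret bound for the average `c` of the expected auxiliary vectors. -/
theorem utility_le_utility_meanγ (hr : IsUCBRun P S φ V δ ℱ Y M γ Q) (hS : IsLinkProcess P q S)
    (hV : 0 < V) (hB : 0 ≤ B) (hφ : IsUtility φ B) {y : Fin n → Fin m → ℝ} (hy : IsFractional y)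
    (hx : (fun i => ∑ j, q i j * y i j) ∈ cube n) (hδ : ∀ t, max n m ≤ t → 0 < δ t) {T : ℕ}
    (hT : max n m + 1 ≤ T) {c : Fin n → ℝ} (hc : c ∈ cube n) {l : ℝ}
    (hl : l = (T : ℝ) - (max n m : ℕ))
    (hcγ : ∀ i, ∑ t ∈ Finset.Icc (max n m + 1) T, ∫ ω, γ t ω i ∂P = l * c i) :
    φ (fun i => ∑ j, q i j * y i j) ≤ φ c + n / (2 * V)
      + 2 * (B * V + 1) / (V * l) * ∑ t ∈ Finset.Icc (max n m + 1) T, ∑ i, ∑ j,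
          ∫ ω, Y t ω i j * confWidth δ Y (t - 1) ω i j ∂P
      + 2 * (n * B * V + n) * n * m / (V * l) * ∑ t ∈ Finset.Icc (max n m) (T - 1), δ t := by
  obtain ⟨g, -, hg⟩ := hφ.subgrad c hc
  have hl0 : 0 < l := by
    have : ((max n m : ℕ) : ℝ) + 1 ≤ T := by exact_mod_cast hT
    linarith
  have h := hr.sum_drift_le hS hV hB hφ hy hx hg hδ (by omega : max n m ≤ T)
  have hcard : (((Finset.Icc (max n m + 1) T).card : ℕ) : ℝ) = l := by
    rw [Nat.card_Icc, hl, Nat.cast_sub (by omega)]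
    push_cast; ring
  -- This is why the linearization is taken at `c`, the average of the expected auxiliary vectors.
  have hγ0 : ∑ t ∈ Finset.Icc (max n m + 1) T, ∑ i, g i * ((∫ ω, γ t ω i ∂P) - c i) = 0 := by
    rw [Finset.sum_comm]
    refine Finset.sum_eq_zero fun i _ => ?_
    rw [← Finset.mul_sum, Finset.sum_sub_distrib, hcγ, Finset.sum_const, nsmul_eq_mul, hcard,
      sub_self, mul_zero]
  have hδsum : ∑ t ∈ Finset.Icc (max n m + 1) T, δ (t - 1) =
      ∑ t ∈ Finset.Icc (max n m) (T - 1), δ t := by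
    refine Finset.sum_nbij' (fun t => t - 1) (fun t => t + 1) ?_ ?_ ?_ ?_ fun _ _ => rfl <;>
      intro t ht <;> simp only [Finset.mem_Icc] at ht ⊢ <;> omega
  simp only [Finset.sum_add_distrib, ← Finset.mul_sum, Finset.sum_const, nsmul_eq_mul, hcard, hγ0,
    hδsum] at h
  set F := ∑ t ∈ Finset.Icc (max n m + 1) T, ∑ i, ∑ j,
    ∫ ω, Y t ω i j * confWidth δ Y (t - 1) ω i j ∂P
  set D := ∑ t ∈ Finset.Icc (max n m) (T - 1), δ t
  have hVl : 0 < V * l := mul_pos hV hl0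
  have key : φ c + n / (2 * V) + 2 * (B * V + 1) / (V * l) * F
      + 2 * (n * B * V + n) * n * m / (V * l) * D - φ (fun i => ∑ j, q i j * y i j) =
      (l * (n / 2) + V * (l * (φ c - φ fun i => ∑ j, q i j * y i j)) + V * 0 +
        2 * (B * V + 1) * F + n * (B * V + 1) * (2 * n * m * D)) / (V * l) := by
    field_simp
    ring
  have := div_nonneg h hVl.le
  rw [← key] at this
  linarith

/-- The regret bound, with constants slightly better than needed. -/
theorem utility_le (hr : IsUCBRun P S φ V δ ℱ Y M γ Q) (hS : IsLinkProcess P q S)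
    (hV : 0 < V) (hB : 0 ≤ B) (hφ : IsUtility φ B) {y : Fin n → Fin m → ℝ} (hy : IsFractional y)
    (hx : (fun i => ∑ j, q i j * y i j) ∈ cube n) (hδ : ∀ t, max n m ≤ t → 0 < δ t) {T : ℕ}
    (hT : max n m + 1 ≤ T) :
    φ (fun i => ∑ j, q i j * y i j) ≤ φ (meanSuccess P S Y T) + (n / V
      + 2 * (B * V + 1) / (V * (T - (max n m : ℕ))) * ∑ t ∈ Finset.Icc (max n m + 1) T, ∑ i, ∑ j,
          ∫ ω, Y t ω i j * confWidth δ Y (t - 1) ω i j ∂P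
      + 2 * (n * B * V + n) * n * m / (V * (T - (max n m : ℕ))) *
          ∑ t ∈ Finset.Icc (max n m) (T - 1), δ t
      + n * B * (B * V + 1) / (T - (max n m : ℕ))
      + B * (min n m : ℕ) * (max n m : ℕ) / T) := by
  obtain ⟨l, hl⟩ : ∃ l : ℝ, l = (T : ℝ) - (max n m : ℕ) := ⟨_, rfl⟩
  have hTl : ((max n m : ℕ) : ℝ) + 1 ≤ T := by exact_mod_cast hT
  have hl0 : 0 < l := by linarith
  have hs0 : (0 : ℝ) ≤ (max n m : ℕ) := Nat.cast_nonneg _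
  have hT0 : (0 : ℝ) < T := by linarith
  have hcard : (((Finset.Icc (max n m + 1) T).card : ℕ) : ℝ) = l := by
    rw [Nat.card_Icc, hl, Nat.cast_sub (by omega)]
    push_cast; ring
  have hX : ∀ t, 1 ≤ t → ∀ i, ∫ ω, success S Y t ω i ∂P ∈ Set.Icc (0 : ℝ) 1 := by
    intro t ht i
    refine ⟨integral_nonneg fun ω => (success_mem hS ht (hr.assignment ht ω) i).1, ?_⟩
    refine (integral_mono (hS.integrable_success ht (hr.measurable_Y ht) (hr.assignment ht) i)
      (integrable_const (1 : ℝ)) fun ω => (success_mem hS ht (hr.assignment ht ω) i).2).trans ?_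
    simp
  have hγ : ∀ t, max n m < t → ∀ i, ∫ ω, γ t ω i ∂P ∈ Set.Icc (0 : ℝ) 1 := by
    intro t ht i
    refine ⟨integral_nonneg fun ω => (hr.γ_mem t ht ω).1 i, ?_⟩
    refine (integral_mono (hr.integrable_γ ht i)
      (integrable_const (1 : ℝ)) fun ω => (hr.γ_mem t ht ω).2 i).trans ?_
    simp
  have havg : ∀ f : ℕ → Fin n → ℝ, (∀ t, max n m < t → ∀ i, f t i ∈ Set.Icc (0 : ℝ) 1) →
      (fun i => (∑ t ∈ Finset.Icc (max n m + 1) T, f t i) / l) ∈ cube n := by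
    intro f hf
    have hf' : ∀ i, ∀ t ∈ Finset.Icc (max n m + 1) T, f t i ∈ Set.Icc (0 : ℝ) 1 := fun i t ht =>
      hf t (Finset.mem_Icc.1 ht).1 i
    refine ⟨fun i => div_nonneg (Finset.sum_nonneg fun t ht => (hf' i t ht).1) hl0.le, fun i => ?_⟩
    refine div_le_one_of_le₀ ?_ hl0.le
    refine (Finset.sum_le_sum fun t ht => (hf' i t ht).2).trans ?_
    rw [Finset.sum_const, nsmul_eq_mul, hcard, mul_one]
  set c : Fin n → ℝ := fun i => (∑ t ∈ Finset.Icc (max n m + 1) T, ∫ ω, γ t ω i ∂P) / l with hcdef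
  set z : Fin n → ℝ := fun i =>
    (∑ t ∈ Finset.Icc (max n m + 1) T, ∫ ω, success S Y t ω i ∂P) / l with hzdef
  have hc : c ∈ cube n := havg (fun t i => ∫ ω, γ t ω i ∂P) hγ
  have hz : z ∈ cube n := havg (fun t i => ∫ ω, success S Y t ω i ∂P) fun t ht => hX t (by omega)
  have hmean := meanSuccess_mem_cube P hS (fun t ht => hr.assignment ht) T
  have h1 := hr.utility_le_utility_meanγ hS hV hB hφ hy hx hδ hT hc hl
    fun i => (mul_div_cancel₀ _ hl0.ne').symm
  -- From auxiliary vectors to successes after exploration: each coordinate of `c` exceeds that of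
  -- `z` by at most the queue bound divided by `l`.
  have h2 : φ c ≤ φ z + n * B * (B * V + 1) / l := by
    refine (hφ.le_add_posPart hz hc).trans ?_
    have : ∑ i, max (c i - z i) 0 ≤ n * ((B * V + 1) / l) := by
      refine (Finset.sum_le_sum fun i _ => (?_ : _ ≤ (B * V + 1) / l)).trans (by simp)
      refine max_le ?_ (by positivity)
      rw [hcdef, hzdef, ← sub_div, ← Finset.sum_sub_distrib]
      gcongr
      exact hr.sum_γ_sub_success_le hS hV hB hφ (by omega) i
    have h := mul_le_mul_of_nonneg_left this hB
    have e : B * (n * ((B * V + 1) / l)) = n * B * (B * V + 1) / l := by ring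
    linarith
  have h3 : φ z ≤ φ (meanSuccess P S Y T) + B * (min n m : ℕ) * (max n m : ℕ) / T := by
    refine (hφ.le_add_posPart hmean hz).trans ?_
    -- Dropping the exploration slots gives `(T - s) * z i ≤ T * meanSuccess i` with `s = max n m`,
    -- so the shortfall is at most `s / T` times `z i`. Summing over `i` then brings in `min n m`,
    -- the most links usable in one slot.
    have hi : ∀ i, max (z i - meanSuccess P S Y T i) 0 ≤ (max n m : ℕ) / T * z i := by
      intro i
      refine max_le ?_ (mul_nonneg (by positivity) (hz.1 i))
      have hsum : T * meanSuccess P S Y T i = ∑ t ∈ Finset.Icc 1 T, ∫ ω, success S Y t ω i ∂P := by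
        unfold meanSuccess
        rw [integral_const_mul, integral_finsetSum _ fun t ht =>
          hS.integrable_success (Finset.mem_Icc.1 ht).1 (hr.measurable_Y (Finset.mem_Icc.1 ht).1)
            (hr.assignment (Finset.mem_Icc.1 ht).1) i]
        field_simp
      have hge : l * z i ≤ T * meanSuccess P S Y T i := by
        rw [hsum, hzdef, mul_div_cancel₀ _ hl0.ne']
        refine Finset.sum_le_sum_of_subset_of_nonneg (Finset.Icc_subset_Icc (by omega) le_rfl) ?_
        intro t ht _
        exact (hX t (Finset.mem_Icc.1 ht).1 i).1
      have h4 : T * (z i - meanSuccess P S Y T i) ≤ (max n m : ℕ) * z i := by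
        rw [hl] at hge
        linarith
      rw [div_mul_eq_mul_div, le_div_iff₀' hT0]
      exact h4
    have hzsum : ∑ i, z i ≤ (min n m : ℕ) := by
      rw [hzdef, ← Finset.sum_div, div_le_iff₀ hl0, Finset.sum_comm]
      refine (Finset.sum_le_sum fun t ht => (?_ : _ ≤ ((min n m : ℕ) : ℝ))).trans ?_
      · have ht1 : 1 ≤ t := by have := (Finset.mem_Icc.1 ht).1; omega
        have iX := fun i => hS.integrable_success ht1 (hr.measurable_Y ht1) (hr.assignment ht1) i
        rw [← integral_finsetSum _ fun i _ => iX i]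
        refine (integral_mono (integrable_finsetSum _ fun i _ => iX i)
          (integrable_const ((min n m : ℕ) : ℝ)) fun ω => ?_).trans (by simp)
        refine (Finset.sum_le_sum fun i _ => Finset.sum_le_sum fun j _ => ?_).trans
          (hr.assignment ht1 ω).sum_le_min
        refine mul_le_of_le_one_right ((hr.assignment ht1 ω).nonneg i j) ?_
        rcases hS.zero_one t ht1 ω i j with h | h <;> simp [h]
      · rw [Finset.sum_const, nsmul_eq_mul, hcard, mul_comm]
    have h5 : ∑ i, max (z i - meanSuccess P S Y T i) 0 ≤ (max n m : ℕ) / T * (min n m : ℕ) := by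
      refine (Finset.sum_le_sum fun i _ => hi i).trans ?_
      rw [← Finset.mul_sum]
      gcongr
    have h := mul_le_mul_of_nonneg_left h5 hB
    have e : B * ((max n m : ℕ) / T * (min n m : ℕ)) = B * (min n m : ℕ) * (max n m : ℕ) / (T : ℝ) := by
      ring
    linarith
  have h4 : (n : ℝ) / (2 * V) ≤ n / V := by
    gcongr; linarith
  rw [← hl]
  linarith

/-! ### Comparison with `φ^opt` -/

/-- The regret bound for `φ^opt`. -/
theorem phiOpt_sub_le (hr : IsUCBRun P S φ V δ ℱ Y M γ Q) (hS : IsLinkProcess P q S)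
    (hV : 0 < V) (hB : 0 ≤ B) (hφ : IsUtility φ B) (hδ : ∀ t, max n m ≤ t → 0 < δ t) {T : ℕ}
    (hT : max n m + 1 ≤ T) :
    phiOpt P S φ - φ (meanSuccess P S Y T) ≤ n / V
      + 2 * (B * V + 1) / (V * (T - (max n m : ℕ))) * ∑ t ∈ Finset.Icc (max n m + 1) T, ∑ i, ∑ j,
          ∫ ω, Y t ω i j * confWidth δ Y (t - 1) ω i j ∂P
      + 2 * (n * B * V + n) * n * m / (V * (T - (max n m : ℕ))) *
          ∑ t ∈ Finset.Icc (max n m) (T - 1), δ t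
      + n * B * (B * V + 1) / (T - (max n m : ℕ))
      + B * (min n m : ℕ) * (max n m : ℕ) / T := by
  rw [sub_le_iff_le_add']
  exact hS.phiOpt_le hφ fun y hy hx => hr.utility_le hS hV hB hφ hy hx hδ hT

/-- The mean success vector at a finite horizon is itself a point of the capacity region, hence
attained in the limit by a fixed sequence of assignments. -/
theorem utility_meanSuccess_le_phiOpt (hr : IsUCBRun P S φ V δ ℱ Y M γ Q)
    (hS : IsLinkProcess P q S) (hB : 0 ≤ B) (hφ : IsUtility φ B) {T : ℕ} (hT : 1 ≤ T) :
    φ (meanSuccess P S Y T) ≤ phiOpt P S φ := by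
  have hind : ∀ t, 1 ≤ t → IndepFun (Y t) (S t) P := by
    intro t ht
    obtain ⟨u, rfl⟩ := Nat.exists_eq_add_of_le' ht
    exact hr.indepFun (hr.Y_meas u)
  have hm := meanSuccess_mem_cube P hS (fun t ht => hr.assignment ht) T
  have he := hS.meanSuccess_eq (fun t ht => hr.measurable_Y ht) (fun t ht => hr.assignment ht) hind T
  rw [he] at hm ⊢
  exact hS.le_phiOpt hB hφ
    (isFractional_avgUse (fun t ht => hr.measurable_Y ht) (fun t ht => hr.assignment ht) hT) hm

/-! ### Explicit bounds for `δ t = 1 / t` -/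

/-- The sum of the confidence widths along the uses of a link, when `δ t = 1 / t`. -/
theorem sum_confWidth_le (hr : IsUCBRun P S φ V δ ℱ Y M γ Q) (hn : 0 < n)
    (hδ : ∀ t, max n m ≤ t → δ t = 1 / (t : ℝ)) (T : ℕ) (ω : Ω) (i : Fin n) (j : Fin m) :
    ∑ t ∈ Finset.Icc (max n m + 1) T, Y t ω i j * confWidth δ Y (t - 1) ω i j ≤
      √6 * √(T * Real.log T) := by
  rcases lt_or_ge T (max n m) with hT | hT
  · rw [Finset.Icc_eq_empty (by omega)]; simp only [Finset.sum_empty]; positivity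
  -- With `k` earlier uses the width is at most a constant times `1 / √k ≤ 2 * √k - 2 * √(k - 1)`.
  -- Shifting the count by 1 makes the right side telescope in `t`, with zero increments when the
  -- link is idle.
  have hstep : ∀ t ∈ Finset.Icc (max n m + 1) T, Y t ω i j * confWidth δ Y (t - 1) ω i j ≤
      √(3 * Real.log T / 2) * (2 * √(pulls Y t ω i j - 1) - 2 * √(pulls Y (t - 1) ω i j - 1)) := by
    intro t ht
    obtain ⟨ht1, htT⟩ := Finset.mem_Icc.1 ht
    obtain ⟨u, rfl⟩ := Nat.exists_eq_add_of_le' (by omega : 1 ≤ t)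
    rw [Nat.add_sub_cancel]
    have hsucc : pulls Y (u + 1) ω i j = pulls Y u ω i j + Y (u + 1) ω i j := by
      unfold pulls; rw [Finset.sum_Icc_succ_top (by omega)]
    rcases (hr.assignment (by omega : 1 ≤ u + 1) ω).zero_one i j with h | h
    · rw [hsucc, h]; simp
    · obtain ⟨k, hk, hku⟩ := hr.exists_pulls_eq u ω i j
      have hk1 := hr.one_le_pulls (by omega : max n m ≤ u) ω i j
      rw [hsucc, h, one_mul, hk]
      rw [hk] at hk1
      have hu0 : (0 : ℝ) < u := by
        have : n ≤ max n m := le_max_left n m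
        exact_mod_cast (by omega : 0 < u)
      have hkT : (k : ℝ) + 1 ≤ T := by exact_mod_cast (by omega : k + 1 ≤ T)
      have huT : (u : ℝ) ≤ T := by exact_mod_cast (by omega : u ≤ T)
      -- Each of `k`, `k + 1` and `1 / δ u = u` is at most `T`.
      have hlog : Real.log (k * (k + 1) / δ u) ≤ 3 * Real.log T := by
        rw [hδ u (by omega), show (3 : ℝ) = (3 : ℕ) by norm_num, ← Real.log_pow]
        have hpos : (0 : ℝ) < k * (k + 1) / (1 / u) := by positivity
        refine Real.log_le_log hpos ?_
        calc (k : ℝ) * (k + 1) / (1 / u) = k * (k + 1) * u := by field_simp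
          _ ≤ T * T * T := by gcongr; linarith
          _ = (T : ℝ) ^ 3 := by ring
      have hk0 : (0 : ℝ) < k := by linarith
      have hconf : confWidth δ Y u ω i j ≤ √(3 * Real.log T / 2) * (1 / √k) := by
        unfold confWidth
        rw [hk, one_div, ← Real.sqrt_inv, ← Real.sqrt_mul' _ (by positivity)]
        refine Real.sqrt_le_sqrt ?_
        rw [div_le_iff₀ (by positivity)]
        refine hlog.trans (le_of_eq ?_)
        field_simp
      refine hconf.trans ?_
      gcongr
      rw [add_sub_cancel_right]
      have ha := Real.sq_sqrt hk0.le
      have hb := Real.sq_sqrt (by linarith : (0 : ℝ) ≤ k - 1)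
      have hsk : 0 < √(k : ℝ) := Real.sqrt_pos.2 hk0
      rw [div_le_iff₀ hsk]
      nlinarith [sq_nonneg (√(k : ℝ) - √((k : ℝ) - 1))]
  refine (Finset.sum_le_sum hstep).trans ?_
  rw [← Finset.mul_sum]
  have htel : ∀ U, max n m ≤ U → ∑ t ∈ Finset.Icc (max n m + 1) U,
      (2 * √(pulls Y t ω i j - 1) - 2 * √(pulls Y (t - 1) ω i j - 1)) =
      2 * √(pulls Y U ω i j - 1) - 2 * √(pulls Y (max n m) ω i j - 1) := by
    intro U hU
    induction U, hU using Nat.le_induction with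
    | base => simp
    | succ U hU ih =>
      rw [Finset.sum_Icc_succ_top (by omega), ih, Nat.add_sub_cancel]
      ring
  obtain ⟨k, hk, hkT⟩ := hr.exists_pulls_eq T ω i j
  have hkT' : (k : ℝ) ≤ T := by exact_mod_cast hkT
  have hlog0 : 0 ≤ Real.log T := Real.log_natCast_nonneg T
  have h4 : 2 * √(T : ℝ) = √(4 * T) := by
    rw [Real.sqrt_mul (by norm_num), show (4 : ℝ) = 2 ^ 2 by norm_num, Real.sqrt_sq zero_le_two]
  calc _ ≤ √(3 * Real.log T / 2) * (2 * √(T : ℝ)) := by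
        rw [htel T hT, hk]
        gcongr
        have : √((k : ℝ) - 1) ≤ √(T : ℝ) := Real.sqrt_le_sqrt (by linarith)
        linarith [Real.sqrt_nonneg (pulls Y (max n m) ω i j - 1)]
    _ = √6 * √(T * Real.log T) := by
        rw [h4, ← Real.sqrt_mul (by positivity), ← Real.sqrt_mul (by norm_num)]
        congr 1; ring

theorem sum_integral_confWidth_le (hr : IsUCBRun P S φ V δ ℱ Y M γ Q) (hn : 0 < n)
    (hδ : ∀ t, max n m ≤ t → δ t = 1 / (t : ℝ)) (T : ℕ) :
    ∑ t ∈ Finset.Icc (max n m + 1) T, ∑ i, ∑ j,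
      ∫ ω, Y t ω i j * confWidth δ Y (t - 1) ω i j ∂P ≤ n * m * (√6 * √(T * Real.log T)) := by
  rw [Finset.sum_comm]
  refine (Finset.sum_le_sum fun i _ => (?_ : _ ≤ m * (√6 * √(T * Real.log T)))).trans
    (by simp [mul_assoc])
  rw [Finset.sum_comm]
  refine (Finset.sum_le_sum fun j _ => (?_ : _ ≤ √6 * √(T * Real.log T))).trans (by simp)
  have hi : ∀ t ∈ Finset.Icc (max n m + 1) T,
      Integrable (fun ω => Y t ω i j * confWidth δ Y (t - 1) ω i j) P := fun t ht =>
    hr.integrable_Y_mul_confWidth (by have := (Finset.mem_Icc.1 ht).1; omega) _ i j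
  rw [← integral_finsetSum _ hi]
  refine (integral_mono (integrable_finsetSum _ hi) (integrable_const _) fun ω =>
    hr.sum_confWidth_le hn hδ T ω i j).trans (by simp)

end IsUCBRun

end

theorem inv_succ_le_log_sub {k : ℕ} (hk : 1 ≤ k) :
    1 / ((k + 1 : ℕ) : ℝ) ≤ Real.log (k + 1 : ℕ) - Real.log k := by
  have hk0 : (0 : ℝ) < k := by exact_mod_cast hk
  have h := Real.one_sub_inv_le_log_of_pos (x := ((k + 1 : ℕ) : ℝ) / k) (by positivity)
  rw [Real.log_div (by positivity) hk0.ne'] at h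
  refine le_trans (le_of_eq ?_) h
  push_cast
  field_simp
  ring

theorem sum_Icc_one_inv_le {U : ℕ} (hU : 1 ≤ U) :
    ∑ t ∈ Finset.Icc 1 U, 1 / (t : ℝ) ≤ Real.log U + 1 := by
  induction U, hU using Nat.le_induction with
  | base => simp
  | succ U hU ih =>
    rw [Finset.sum_Icc_succ_top (by omega)]
    linarith [inv_succ_le_log_sub hU]

theorem sum_Icc_two_inv_le {U : ℕ} (hU : 1 ≤ U) :
    ∑ t ∈ Finset.Icc 2 U, 1 / (t : ℝ) ≤ Real.log U := by
  induction U, hU using Nat.le_induction with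
  | base => simp
  | succ U hU ih =>
    rw [Finset.sum_Icc_succ_top (by omega)]
    linarith [inv_succ_le_log_sub hU]

section

variable {Ω : Type u} [MeasurableSpace Ω] {n m : ℕ} {P : Measure Ω} [IsProbabilityMeasure P]
  {q : Fin n → Fin m → ℝ} {S Y : ℕ → Ω → Fin n → Fin m → ℝ} {φ : (Fin n → ℝ) → ℝ} {B V : ℝ}
  {δ : ℕ → ℝ} {ℱ : Filtration ℕ ‹MeasurableSpace Ω›}
  {M : ℕ → Ω → Matrix (Fin (max n m)) (Fin (max n m)) ℝ} {γ Q : ℕ → Ω → Fin n → ℝ}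

/-- The explicit regret bound for `δ t = 1 / t`. -/
theorem IsUCBRun.phiOpt_sub_le_explicit (hr : IsUCBRun P S φ V δ ℱ Y M γ Q)
    (hS : IsLinkProcess P q S) (hn : 0 < n) (hV : 0 < V) (hφ : IsUtility φ B)
    (hδ : ∀ t, max n m ≤ t → δ t = 1 / (t : ℝ)) {T : ℕ} (hT : max n m + 1 ≤ T) :
    phiOpt P S φ - φ (meanSuccess P S Y T) ≤ n / V
      + 2 * √6 * n * m * (B * V + 1) * √(T * Real.log T) / (V * (T - (max n m : ℕ)))
      + 2 * (2 * V * phiMax φ + n * B * V + n) * n * m * (Real.log T + 1) /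
          (V * (T - (max n m : ℕ)))
      + n * B * (B * V + 1) / (T - (max n m : ℕ))
      + (√n * B + 1) * (max n m : ℕ) / T := by
  have hB := hφ.bound_nonneg hn
  have hnm : n ≤ max n m := le_max_left n m
  have hδ0 : ∀ t, max n m ≤ t → 0 < δ t := fun t ht => by
    rw [hδ t ht]
    have : (0 : ℝ) < t := by exact_mod_cast (by omega : 0 < t)
    positivity
  have h := hr.phiOpt_sub_le hS hV hB hφ hδ0 hT
  have hF := hr.sum_integral_confWidth_le hn hδ T
  set F := ∑ t ∈ Finset.Icc (max n m + 1) T, ∑ i, ∑ j,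
    ∫ ω, Y t ω i j * confWidth δ Y (t - 1) ω i j ∂P
  have hD : ∑ t ∈ Finset.Icc (max n m) (T - 1), δ t =
      ∑ t ∈ Finset.Icc (max n m) (T - 1), 1 / (t : ℝ) :=
    Finset.sum_congr rfl fun t ht => hδ t (Finset.mem_Icc.1 ht).1
  rw [hD] at h
  set D := ∑ t ∈ Finset.Icc (max n m) (T - 1), 1 / (t : ℝ) with hDdef
  obtain ⟨s, hs⟩ : ∃ s : ℝ, s = ((max n m : ℕ) : ℝ) := ⟨_, rfl⟩
  obtain ⟨l, hl⟩ : ∃ l : ℝ, l = (T : ℝ) - s := ⟨_, rfl⟩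
  have hTl : ((max n m : ℕ) : ℝ) + 1 ≤ T := by exact_mod_cast hT
  have hs0 : 0 ≤ s := by rw [hs]; positivity
  have hl0 : 0 < l := by linarith
  have hT0 : (0 : ℝ) < T := by linarith
  have hlT : l ≤ T := by linarith
  have hlogT : Real.log ((T - 1 : ℕ) : ℝ) ≤ Real.log T :=
    Real.log_le_log (by exact_mod_cast (by omega : 0 < T - 1)) (by exact_mod_cast Nat.sub_le T 1)
  have hlog0 : 0 ≤ Real.log T := Real.log_natCast_nonneg T
  have hsq : 1 ≤ √(n : ℝ) := Real.one_le_sqrt.2 (by exact_mod_cast hn)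
  have hΦ : 0 ≤ phiMax φ := phiMax_nonneg
  rw [← hs, ← hl] at h ⊢
  have hfirst : 2 * (B * V + 1) / (V * l) * F ≤
      2 * √6 * n * m * (B * V + 1) * √(T * Real.log T) / (V * l) := by
    calc _ ≤ 2 * (B * V + 1) / (V * l) * (n * m * (√6 * √(T * Real.log T))) := by gcongr
      _ = _ := by ring
  -- The last term has `√n` in place of `min n m`, which may be larger. If `max n m ≥ 2`, the
  -- harmonic sum starts at 2 or later and is at most `log T`, so the spare `+ 1` beside the
  -- logarithm absorbs `B * min n m * s / T`, as `min n m * s = n * m`. Otherwise `min n m ≤ 1 ≤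
  -- √n`.
  have hsecond : 2 * (n * B * V + n) * n * m / (V * l) * D + B * (min n m : ℕ) * s / T ≤
      2 * (n * B * V + n) * n * m * (Real.log T + 1) / (V * l) + (√n * B + 1) * s / T := by
    have hnonneg : ∀ t : ℕ, 0 ≤ 1 / (t : ℝ) := fun t => by positivity
    rcases Nat.lt_or_ge (max n m) 2 with h2 | h2
    · have h3 : D ≤ Real.log T + 1 := by
        refine (Finset.sum_le_sum_of_subset_of_nonneg
          (Finset.Icc_subset_Icc_left (by omega)) fun t _ _ => hnonneg t).trans
          ((sum_Icc_one_inv_le (by omega)).trans ?_)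
        linarith
      have h4 : ((min n m : ℕ) : ℝ) ≤ 1 := by exact_mod_cast (by omega : min n m ≤ 1)
      have h5 : B * (min n m : ℕ) * s / T ≤ (√n * B + 1) * s / T := by
        gcongr
        have := mul_le_mul_of_nonneg_left (h4.trans hsq) hB
        linarith
      have h6 : 2 * (n * B * V + n) * n * m / (V * l) * D ≤
          2 * (n * B * V + n) * n * m * (Real.log T + 1) / (V * l) := by
        rw [mul_div_right_comm _ (Real.log T + 1)]
        gcongr
      linarith
    · have h3 : D ≤ Real.log T := by
        refine (Finset.sum_le_sum_of_subset_of_nonneg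
          (Finset.Icc_subset_Icc_left h2) fun t _ _ => hnonneg t).trans
          ((sum_Icc_two_inv_le (by omega)).trans hlogT)
      have h4 : ((min n m : ℕ) : ℝ) * s = n * m := by
        rw [hs]; exact_mod_cast min_mul_max n m
      have h5 : B * (min n m : ℕ) * s / T ≤ 2 * (n * B * V + n) * n * m / (V * l) := by
        rw [mul_assoc, h4]
        have h1n : (1 : ℝ) ≤ n := by exact_mod_cast hn
        calc B * (n * m) / T ≤ B * (n * m) / l := by gcongr
          _ = (1 * B * V) * n * m / (V * l) := by field_simp
          _ ≤ 2 * (n * B * V + n) * n * m / (V * l) := by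
            have h0 : 0 ≤ n * B * V := by positivity
            have h9 : 1 * B * V ≤ n * B * V := by gcongr
            have h10 : 1 * B * V ≤ 2 * (n * B * V + n) := by linarith
            exact div_le_div_of_nonneg_right (mul_le_mul_of_nonneg_right
              (mul_le_mul_of_nonneg_right h10 (Nat.cast_nonneg _)) (Nat.cast_nonneg _))
              (by positivity)
      have h6 : 2 * (n * B * V + n) * n * m / (V * l) * D ≤
          2 * (n * B * V + n) * n * m / (V * l) * Real.log T := by
        gcongr
      have h7 : 2 * (n * B * V + n) * n * m * (Real.log T + 1) / (V * l) =
          2 * (n * B * V + n) * n * m / (V * l) * Real.log T +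
            2 * (n * B * V + n) * n * m / (V * l) := by ring
      have h8 : 0 ≤ (√n * B + 1) * s / T := by positivity
      linarith
  have hthird : 2 * (n * B * V + n) * n * m * (Real.log T + 1) / (V * l) ≤
      2 * (2 * V * phiMax φ + n * B * V + n) * n * m * (Real.log T + 1) / (V * l) := by
    gcongr
    have : 0 ≤ 2 * V * phiMax φ := by positivity
    linarith
  linarith

end

/-! ### Asymptotic rates -/

/-- The rate `√(log T / T)` dominates `1 / √T` and `log T / T`. -/
theorem rate_bounds {T : ℕ} (hT : 2 ≤ T) :
    1 / √(T : ℝ) ≤ 2 * √(Real.log T / T) ∧ 1 / (T : ℝ) ≤ 2 * √(Real.log T / T) ∧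
      (Real.log T + 1) / T ≤ 3 * √(Real.log T / T) := by
  have hT' : (2 : ℝ) ≤ T := by exact_mod_cast hT
  have hT0 : (0 : ℝ) < T := by linarith
  -- Any positive lower bound on `log 2` would do; `1 / 4` is a perfect square, which yields the
  -- factor 2.
  have hlog : 1 / 4 ≤ Real.log T := by
    have := Real.log_two_gt_d9
    have := Real.log_le_log zero_lt_two hT'
    linarith
  have h1 : 1 / √(T : ℝ) ≤ 2 * √(Real.log T / T) := by
    rw [Real.sqrt_div (by linarith), ← mul_div_assoc]
    gcongr
    have : √(1 / 4 : ℝ) ≤ √(Real.log T) := Real.sqrt_le_sqrt hlog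
    rw [show (1 / 4 : ℝ) = (1 / 2) ^ 2 by norm_num, Real.sqrt_sq (by norm_num)] at this
    linarith
  have h2 : 1 / (T : ℝ) ≤ 1 / √(T : ℝ) := by
    gcongr
    rw [Real.sqrt_le_left hT0.le]
    nlinarith
  have h3 : Real.log T / T ≤ √(Real.log T / T) := by
    have h0 : 0 ≤ Real.log T / T := div_nonneg (by linarith) hT0.le
    refine Real.le_sqrt_of_sq_le ?_
    have h1 : Real.log T / T ≤ 1 := by
      rw [div_le_one hT0]
      linarith [Real.log_le_sub_one_of_pos hT0]
    rw [sq]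
    exact mul_le_of_le_one_right h0 h1
  refine ⟨h1, h2.trans h1, ?_⟩
  rw [add_div]
  linarith

/-- The explicit regret bound in terms of the rate `√(log T / T)`. -/
theorem explicit_bound_le_rate {n m s T : ℕ} {B V Φ : ℝ} (hB : 0 ≤ B) (hV : 0 < V) (hΦ : 0 ≤ Φ)
    (hs : 1 ≤ s) (hT : 2 * s ≤ T) :
    n / V
      + 2 * √6 * n * m * (B * V + 1) * √(T * Real.log T) / (V * (T - s))
      + 2 * (2 * V * Φ + n * B * V + n) * n * m * (Real.log T + 1) / (V * (T - s))
      + n * B * (B * V + 1) / (T - s)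
      + (√n * B + 1) * s / T ≤
    -- The terms `n / V` and `V / T` stay apart from the rate: for fixed `V` only `n / V` survives
    -- as `T` grows, while for `V` of order `√T` both are of order `1 / √T`.
    n / V + (4 * √6 * n * m * (B + 1) + 12 * (2 * Φ + n * B + n) * n * m + 4 * n * B
      + 2 * (√n * B + 1) * s) * (1 + 1 / V) * √(Real.log T / T) + 2 * n * B ^ 2 * (V / T) := by
  have hT2 : 2 ≤ T := by omega
  obtain ⟨-, h1, h2⟩ := rate_bounds hT2
  set ρ := √(Real.log T / T) with hρ
  have hρ0 : 0 ≤ ρ := Real.sqrt_nonneg _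
  have hsR : (2 : ℝ) * s ≤ T := by exact_mod_cast hT
  have hs1 : (1 : ℝ) ≤ s := by exact_mod_cast hs
  have hT0 : (0 : ℝ) < T := by linarith
  have hl : (0 : ℝ) < T - s := by linarith
  have hlog0 : 0 ≤ Real.log T := Real.log_natCast_nonneg T
  -- This is where `T ≥ 2 * s` enters.
  have hlinv : 1 / ((T : ℝ) - s) ≤ 2 * (1 / T) := by
    rw [mul_one_div, div_le_div_iff₀ hl hT0]
    linarith
  have hsqrt : √(T * Real.log T) * (1 / T) = ρ := by
    rw [hρ, mul_one_div, div_eq_iff hT0.ne']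
    calc √(T * Real.log T) = √(Real.log T / T * (T : ℝ) ^ 2) := by congr 1; field_simp
      _ = √(Real.log T / T) * T := by rw [Real.sqrt_mul (by positivity), Real.sqrt_sq hT0.le]
  have hW0 : 0 < 1 / V := by positivity
  obtain ⟨W, hW⟩ : ∃ W : ℝ, W = 1 / V := ⟨_, rfl⟩
  rw [← hW] at hW0 ⊢
  have hVW : V * W = 1 := by rw [hW]; field_simp
  have e1 : 2 * √6 * n * m * (B * V + 1) * √(T * Real.log T) / (V * (T - s)) ≤
      4 * √6 * n * m * (B + 1) * (1 + W) * ρ := by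
    calc _ = 2 * √6 * n * m * (B + W) * √(T * Real.log T) * (1 / (T - s)) := by
          rw [hW]; field_simp
      _ ≤ 2 * √6 * n * m * (B + W) * √(T * Real.log T) * (2 * (1 / T)) := by gcongr
      _ = 4 * √6 * n * m * (B + W) * ρ := by rw [← hsqrt]; ring
      _ ≤ 4 * √6 * n * m * ((B + 1) * (1 + W)) * ρ := by
          gcongr; nlinarith
      _ = _ := by ring
  have e2 : 2 * (2 * V * Φ + n * B * V + n) * n * m * (Real.log T + 1) / (V * (T - s)) ≤
      12 * (2 * Φ + n * B + n) * n * m * (1 + W) * ρ := by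
    calc _ = 2 * (2 * Φ + n * B + n * W) * n * m * (Real.log T + 1) * (1 / (T - s)) := by
          rw [hW]; field_simp
      _ ≤ 2 * (2 * Φ + n * B + n * W) * n * m * (Real.log T + 1) * (2 * (1 / T)) := by gcongr
      _ = 4 * (2 * Φ + n * B + n * W) * n * m * ((Real.log T + 1) / T) := by ring
      _ ≤ 4 * ((2 * Φ + n * B + n) * (1 + W)) * n * m * (3 * ρ) := by
          gcongr
          have : 0 ≤ (2 * Φ + n * B) * W := by positivity
          have : (0 : ℝ) ≤ n := by positivity
          linarith
      _ = _ := by ring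
  have e3 : n * B * (B * V + 1) / (T - s) ≤ 2 * n * B ^ 2 * (V / T) + 4 * n * B * (1 + W) * ρ := by
    calc _ = n * B * (B * V + 1) * (1 / (T - s)) := by ring
      _ ≤ n * B * (B * V + 1) * (2 * (1 / T)) := by gcongr
      _ = 2 * n * B ^ 2 * (V / T) + 2 * n * B * 1 * (1 / T) := by ring
      _ ≤ 2 * n * B ^ 2 * (V / T) + 2 * n * B * (1 + W) * (2 * ρ) := by
          gcongr; linarith
      _ = _ := by ring
  have e4 : (√n * B + 1) * s / T ≤ 2 * (√n * B + 1) * s * (1 + W) * ρ := by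
    calc _ = (√n * B + 1) * s * 1 * (1 / T) := by ring
      _ ≤ (√n * B + 1) * s * (1 + W) * (2 * ρ) := by gcongr; linarith
      _ = _ := by ring
  linarith

section

variable {Ω : Type u} [MeasurableSpace Ω] {n m : ℕ} {P : Measure Ω} [IsProbabilityMeasure P]
  {q : Fin n → Fin m → ℝ} {S Y : ℕ → Ω → Fin n → Fin m → ℝ} {φ : (Fin n → ℝ) → ℝ} {B V : ℝ}
  {δ : ℕ → ℝ} {ℱ : Filtration ℕ ‹MeasurableSpace Ω›}
  {M : ℕ → Ω → Matrix (Fin (max n m)) (Fin (max n m)) ℝ} {γ Q : ℕ → Ω → Fin n → ℝ}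

/-- The constant in front of the rate `√(log T / T)`. -/
noncomputable def rateConst (n m : ℕ) (φ : (Fin n → ℝ) → ℝ) (B : ℝ) : ℝ :=
  4 * √6 * n * m * (B + 1) + 12 * (2 * phiMax φ + n * B + n) * n * m + 4 * n * B
    + 2 * (√n * B + 1) * (max n m : ℕ)

theorem rateConst_nonneg (hB : 0 ≤ B) : 0 ≤ rateConst n m φ B := by
  have : 0 ≤ phiMax φ := phiMax_nonneg
  unfold rateConst
  positivity

namespace IsUCBRun

theorem phiOpt_sub_le_rate (hr : IsUCBRun P S φ V δ ℱ Y M γ Q) (hS : IsLinkProcess P q S)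
    (hn : 0 < n) (hV : 0 < V) (hφ : IsUtility φ B)
    (hδ : ∀ t, max n m ≤ t → δ t = 1 / (t : ℝ)) {T : ℕ} (hT : 2 * max n m ≤ T) :
    phiOpt P S φ - φ (meanSuccess P S Y T) ≤
      n / V + rateConst n m φ B * (1 + 1 / V) * √(Real.log T / T) + 2 * n * B ^ 2 * (V / T) := by
  have hs : 1 ≤ max n m := le_trans hn (le_max_left n m)
  exact (hr.phiOpt_sub_le_explicit hS hn hV hφ hδ (by omega)).trans
    (explicit_bound_le_rate (hφ.bound_nonneg hn) hV phiMax_nonneg hs hT)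

theorem abs_phiOpt_sub_le_rate (hr : IsUCBRun P S φ V δ ℱ Y M γ Q) (hS : IsLinkProcess P q S)
    (hn : 0 < n) (hφ : IsUtility φ B) (hδ : ∀ t, max n m ≤ t → δ t = 1 / (t : ℝ)) {T : ℕ}
    (hT : 2 * max n m ≤ T) {c₁ c₂ : ℝ} (hc₁ : 0 < c₁) (hc₂ : 0 < c₂) (h₁ : c₁ * √T ≤ V)
    (h₂ : V ≤ c₂ * √T) :
    |phiOpt P S φ - φ (meanSuccess P S Y T)| ≤
      (2 * n / c₁ + rateConst n m φ B * (1 + 1 / c₁) + 4 * n * B ^ 2 * c₂)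
        * √(Real.log T / T) := by
  have hB := hφ.bound_nonneg hn
  have hs : 1 ≤ max n m := le_trans hn (le_max_left n m)
  have hT2 : 2 ≤ T := by omega
  obtain ⟨hr1, -, -⟩ := rate_bounds hT2
  have hK := rateConst_nonneg (n := n) (m := m) (φ := φ) hB
  have hT1 : (1 : ℝ) ≤ √(T : ℝ) := Real.one_le_sqrt.2 (by exact_mod_cast (by omega : 1 ≤ T))
  have hs0 : 0 < √(T : ℝ) := by linarith
  have hV : 0 < V := lt_of_lt_of_le (by positivity) h₁
  rw [abs_of_nonneg (sub_nonneg.2 (hr.utility_meanSuccess_le_phiOpt hS hB hφ (by omega)))]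
  refine (hr.phiOpt_sub_le_rate hS hn hV hφ hδ hT).trans ?_
  set ρ := √(Real.log T / T)
  have hρ0 : 0 ≤ ρ := Real.sqrt_nonneg _
  have e1 : (n : ℝ) / V ≤ 2 * n / c₁ * ρ := by
    calc (n : ℝ) / V ≤ n / (c₁ * √T) := by gcongr
      _ = n / c₁ * (1 / √T) := by field_simp
      _ ≤ n / c₁ * (2 * ρ) := by gcongr
      _ = _ := by ring
  -- Since `√T ≥ 1`, the lower bound on `V` also gives `V ≥ c₁`.
  have e2 : 1 / V ≤ 1 / c₁ := by
    gcongr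
    exact (le_mul_of_one_le_right hc₁.le hT1).trans h₁
  have e3 : 2 * n * B ^ 2 * (V / T) ≤ 4 * n * B ^ 2 * c₂ * ρ := by
    calc 2 * n * B ^ 2 * (V / T) ≤ 2 * n * B ^ 2 * (c₂ * √T / T) := by gcongr
      _ = 2 * n * B ^ 2 * (c₂ * (1 / √T)) := by rw [mul_div_assoc, Real.sqrt_div_self']
      _ ≤ 2 * n * B ^ 2 * (c₂ * (2 * ρ)) := by gcongr
      _ = _ := by ring
  have e4 : rateConst n m φ B * (1 + 1 / V) * ρ ≤ rateConst n m φ B * (1 + 1 / c₁) * ρ := by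
    gcongr
  linarith

/-- For fixed `V` every term of the rate bound except `n / V` vanishes as `T` tends to infinity; the
sign comes from the fact that no horizon beats `φ^opt`. -/
theorem abs_phiOpt_sub_liminf_le (hr : IsUCBRun P S φ V δ ℱ Y M γ Q) (hS : IsLinkProcess P q S)
    (hn : 0 < n) (hV : 0 < V) (hφ : IsUtility φ B)
    (hδ : ∀ t, max n m ≤ t → δ t = 1 / (t : ℝ)) :
    |phiOpt P S φ - liminf (fun T : ℕ => φ (meanSuccess P S Y T)) atTop| ≤ n / V := by
  have hB := hφ.bound_nonneg hn
  have hm := fun T => meanSuccess_mem_cube P hS (fun t ht => hr.assignment ht) T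
  have hle : ∀ᶠ T in atTop, φ (meanSuccess P S Y T) ≤ phiOpt P S φ := by
    filter_upwards [eventually_ge_atTop 1] with T hT
    exact hr.utility_meanSuccess_le_phiOpt hS hB hφ hT
  have hlo : IsBoundedUnder (· ≥ ·) atTop fun T : ℕ => φ (meanSuccess P S Y T) :=
    isBoundedUnder_of ⟨φ 0, fun T => hφ.mono ⟨le_rfl, zero_le_one⟩ (hm T) (hm T).1⟩
  have hup : IsBoundedUnder (· ≤ ·) atTop fun T : ℕ => φ (meanSuccess P S Y T) :=
    isBoundedUnder_of ⟨φ 1, fun T => hφ.mono (hm T) ⟨zero_le_one, le_rfl⟩ (hm T).2⟩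
  have h1 : liminf (fun T : ℕ => φ (meanSuccess P S Y T)) atTop ≤ phiOpt P S φ :=
    liminf_le_of_frequently_le hle.frequently hlo
  rw [abs_of_nonneg (sub_nonneg.2 h1), sub_le_comm]
  have hlog : Tendsto (fun T : ℕ => Real.log T / T) atTop (nhds 0) :=
    (Real.isLittleO_log_id_atTop.tendsto_div_nhds_zero).comp tendsto_natCast_atTop_atTop
  have hρ : Tendsto (fun T : ℕ => √(Real.log T / T)) atTop (nhds 0) := by
    simpa using hlog.sqrt
  have hVT : Tendsto (fun T : ℕ => V / (T : ℝ)) atTop (nhds 0) :=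
    tendsto_const_div_atTop_nhds_zero_nat V
  have hlim : Tendsto (fun T : ℕ => phiOpt P S φ - (n / V + rateConst n m φ B * (1 + 1 / V) *
      √(Real.log T / T) + 2 * n * B ^ 2 * (V / T))) atTop (nhds (phiOpt P S φ - n / V)) := by
    simpa using (((hρ.const_mul (rateConst n m φ B * (1 + 1 / V))).const_add (n / V)).add
      (hVT.const_mul (2 * n * B ^ 2))).const_sub (phiOpt P S φ)
  rw [← hlim.liminf_eq]
  refine liminf_le_liminf ?_ hlim.isBoundedUnder_ge hup.isCoboundedUnder_ge
  filter_upwards [eventually_ge_atTop (2 * max n m)] with T hT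
  linarith [hr.phiOpt_sub_le_rate hS hn hV hφ hδ hT]

end IsUCBRun

end

end MAC

/-! ### The theorem -/

theorem mainTheorem2 {n m : ℕ} (hn : 0 < n) (hm : 0 < m) (s : ℕ) (hs : s = max n m)
    (φ : (Fin n → ℝ) → ℝ) (B : ℝ) (hφ : MAC.IsUtility φ B) :
    -- the general bound
    (∀ (Ω : Type u) [MeasurableSpace Ω] (P : Measure Ω) [IsProbabilityMeasure P]
        (q : Fin n → Fin m → ℝ) (S Y : ℕ → Ω → Fin n → Fin m → ℝ)
        (ℱ : Filtration ℕ ‹MeasurableSpace Ω›)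
        (M : ℕ → Ω → Matrix (Fin (max n m)) (Fin (max n m)) ℝ) (γ Q : ℕ → Ω → Fin n → ℝ)
        (V : ℝ) (δ : ℕ → ℝ) (T : ℕ),
        0 < V → (∀ t, s ≤ t → 0 < δ t) → s + 1 ≤ T →
        MAC.IsLinkProcess P q S → MAC.IsUCBRun P S φ V δ ℱ Y M γ Q →
        MAC.phiOpt P S φ - φ (MAC.meanSuccess P S Y T) ≤
          n / V
          + 2 * (B * V + 1) / (V * (T - s)) *
              ∑ t ∈ Finset.Icc (s + 1) T, ∑ i, ∑ j,
                ∫ ω, Y t ω i j * MAC.confWidth δ Y (t - 1) ω i j ∂P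
          + 2 * (2 * V * MAC.phiMax φ + n * B * V + n) * n * m / (V * (T - s)) *
              ∑ t ∈ Finset.Icc s (T - 1), δ t
          + n * B * (B * V + 1) / (T - s)
          + B * (min n m : ℕ) * s / T) ∧
    -- part 1
    (∀ (Ω : Type u) [MeasurableSpace Ω] (P : Measure Ω) [IsProbabilityMeasure P]
        (q : Fin n → Fin m → ℝ) (S Y : ℕ → Ω → Fin n → Fin m → ℝ)
        (ℱ : Filtration ℕ ‹MeasurableSpace Ω›)
        (M : ℕ → Ω → Matrix (Fin (max n m)) (Fin (max n m)) ℝ) (γ Q : ℕ → Ω → Fin n → ℝ)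
        (V : ℝ) (δ : ℕ → ℝ) (T : ℕ),
        0 < V → (∀ t, s ≤ t → δ t = 1 / (t : ℝ)) → s + 1 ≤ T →
        MAC.IsLinkProcess P q S → MAC.IsUCBRun P S φ V δ ℱ Y M γ Q →
        MAC.phiOpt P S φ - φ (MAC.meanSuccess P S Y T) ≤
          n / V
          + 2 * √6 * n * m * (B * V + 1) * √(T * Real.log T) / (V * (T - s))
          + 2 * (2 * V * MAC.phiMax φ + n * B * V + n) * n * m * (Real.log T + 1) / (V * (T - s))
          + n * B * (B * V + 1) / (T - s)
          + (√n * B + 1) * s / T) ∧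
    -- part 2
    (∀ c₁ c₂ : ℝ, 0 < c₁ → 0 < c₂ → ∃ C : ℝ,
      ∀ (Ω : Type u) [MeasurableSpace Ω] (P : Measure Ω) [IsProbabilityMeasure P]
        (q : Fin n → Fin m → ℝ) (S Y : ℕ → Ω → Fin n → Fin m → ℝ)
        (ℱ : Filtration ℕ ‹MeasurableSpace Ω›)
        (M : ℕ → Ω → Matrix (Fin (max n m)) (Fin (max n m)) ℝ) (γ Q : ℕ → Ω → Fin n → ℝ)
        (V : ℝ) (δ : ℕ → ℝ) (T : ℕ),
        2 * s ≤ T → c₁ * √T ≤ V → V ≤ c₂ * √T → (∀ t, s ≤ t → δ t = 1 / (t : ℝ)) →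
        MAC.IsLinkProcess P q S → MAC.IsUCBRun P S φ V δ ℱ Y M γ Q →
        |MAC.phiOpt P S φ - φ (MAC.meanSuccess P S Y T)| ≤ C * √(Real.log T / T)) ∧
    -- part 3
    (∀ c₁ c₂ : ℝ, 0 < c₁ → 0 < c₂ → ∃ C : ℝ,
      ∀ (Ω : Type u) [MeasurableSpace Ω] (P : Measure Ω) [IsProbabilityMeasure P]
        (q : Fin n → Fin m → ℝ) (S Y : ℕ → Ω → Fin n → Fin m → ℝ)
        (ℱ : Filtration ℕ ‹MeasurableSpace Ω›)
        (M : ℕ → Ω → Matrix (Fin (max n m)) (Fin (max n m)) ℝ) (γ Q : ℕ → Ω → Fin n → ℝ)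
        (V : ℝ) (δ : ℕ → ℝ) (ε : ℝ),
        0 < ε → c₁ / ε ≤ V → V ≤ c₂ / ε → (∀ t, s ≤ t → δ t = 1 / (t : ℝ)) →
        MAC.IsLinkProcess P q S → MAC.IsUCBRun P S φ V δ ℱ Y M γ Q →
        |MAC.phiOpt P S φ - liminf (fun T : ℕ => φ (MAC.meanSuccess P S Y T)) atTop| ≤ C * ε) := by
  subst hs
  have hB := hφ.bound_nonneg hn
  refine ⟨?_, ?_, ?_, ?_⟩
  · intro Ω _ P _ q S Y ℱ M γ Q V δ T hV hδ hT hS hr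
    refine (hr.phiOpt_sub_le hS hV hB hφ hδ hT).trans ?_
    have hl : (0 : ℝ) < T - (max n m : ℕ) := by
      rw [sub_pos]; exact_mod_cast hT
    have hΦ : 0 ≤ MAC.phiMax φ := MAC.phiMax_nonneg
    have hD : 0 ≤ ∑ t ∈ Finset.Icc (max n m) (T - 1), δ t :=
      Finset.sum_nonneg fun t ht => (hδ t (Finset.mem_Icc.1 ht).1).le
    -- The proved bound has no `phiMax` term: a failed interval spoils only the weight comparison,
    -- while the utility comparison in the drift always holds. The stated coefficient is therefore
    -- larger by `2 * V * phiMax φ`.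
    gcongr
    have : 0 ≤ 2 * V * MAC.phiMax φ := by positivity
    linarith
  · intro Ω _ P _ q S Y ℱ M γ Q V δ T hV hδ hT hS hr
    exact hr.phiOpt_sub_le_explicit hS hn hV hφ hδ hT
  · intro c₁ c₂ hc₁ hc₂
    exact ⟨_, fun Ω _ P _ q S Y ℱ M γ Q V δ T hT h₁ h₂ hδ hS hr =>
      hr.abs_phiOpt_sub_le_rate hS hn hφ hδ hT hc₁ hc₂ h₁ h₂⟩
  · intro c₁ c₂ hc₁ hc₂
    refine ⟨n / c₁, fun Ω _ P _ q S Y ℱ M γ Q V δ ε hε h₁ h₂ hδ hS hr => ?_⟩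
    have hV : 0 < V := lt_of_lt_of_le (by positivity) h₁
    refine (hr.abs_phiOpt_sub_liminf_le hS hn hV hφ hδ).trans ?_
    calc (n : ℝ) / V ≤ n / (c₁ / ε) := by gcongr
      _ = n / c₁ * ε := by field_simp
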